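/- Let $\mathbb{L}_{\mathbb R}$ be a real Dedekind complete unital $f$-algebra (multiplication is commutative, as it automatically is), and let $\mathbb{L}$ be either $\mathbb{L}_{\mathbb R}$ itself with modulus $|\lambda| = \lambda\vee(-\lambda)$, or its complexification $\mathbb{L}_{\mathbb R}+i\mathbb{L}_{\mathbb R}$ with modulus $|x+iy| = (x^2+y^2)^{1/2}$. Write $\mathbb{L}^+=\{\lambda\in\mathbb{L}_{\mathbb R}:\lambda\ge 0\}$. For $\lambda\in\mathbb{L}^+$ and a real number $p>0$, the power $\lambda^p\in\mathbb{L}^+$ is the one obtained pointwise when $\mathbb{L}_{\mathbb R}$ is represented by extended-real-valued continuous functions on a Stonean space; intrinsically, $\lambda^p=\sup\{a^p e : a\in[0,\infty),\ e^2=e\in\mathbb{L}_{\mathbb R},\ ae\le\lambda\}$. An $\mathbb{L}$-normed space is an $\mathbb{L}$-module $X$ with a map $\|\cdot\|\colon X\to\mathbb{L}^+$ such that $\|\lambda x\|=|\lambda|\,\|x\|$, $\|x+y\|\le\|x\|+\|y\|$, and $\|x\|=0$ only for $x=0$. A net $(x_\alpha)$ in $X$ converges to $x$ if there is a set $\mathcal{E}\subseteq\mathbb{L}^+$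 with $\inf\mathcal{E}=0$ such that for every $\varepsilon\in\mathcal{E}$ there is $\alpha_0$ with $\|x_\alpha-x\|\le\varepsilon$ for all $\alpha\ge\alpha_0$; a series $\sum_{s\in S}x_s$ is the limit of the net of its finite partial sums. The dual $X^*$ is the $\mathbb{L}$-module of $\mathbb{L}$-linear maps $\varphi\colon X\to\mathbb{L}$ for which some $M\in\mathbb{L}^+$ satisfies $|\varphi(x)|\le M\|x\|$ for all $x\in X$; its norm $\|\varphi\|$ is the infimum of all such $M$. Write $\langle x,\varphi\rangle=\varphi(x)$. Let $S$ be a non-empty set and $Z$ an $\mathbb{L}$-normed space. For $1\le p<\infty$, $\ell^p(S,Z)$ is the space of all $f\colon S\to Z$ for which $\sum_{s\in S}\|f(s)\|^p$ converges in $\mathbb{L}$, with norm $\|f\|_p=\bigl(\sum_{s\in S}\|f(s)\|^p\bigr)^{1/p}$; $\ell^\infty(S,Z)$ is the space of all $f$ whose norms $\|f(s)\|$ have an upper bound in $\mathbb{L}^+$, with $\|f\|_\infty=\sup_{s}\|f(s)\|$; and $c_0(S,Z)$ is the subspace of those $f\in\ell^\infty(S,Z)$ for which there is $\mathcal{E}\subseteq\mathbb{L}^+$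 with $\inf\mathcal{E}=0$ such that for every $\varepsilon\in\mathcal{E}$ there is a cofinite $C\subseteq S$ with $\|f(s)\|\le\varepsilon$ for all $s\in C$. **Theorem.** Let $S$ be a non-empty set, $Y$ an $\mathbb{L}$-normed space, $1\le p<\infty$, and $q\in(1,\infty]$ with $1/p+1/q=1$. 1. For all $f\in\ell^p(S,Y)$ and $g\in\ell^q(S,Y^*)$ the series $B(f,g)=\sum_{s\in S}\langle f(s),g(s)\rangle$ converges in $\mathbb{L}$, $B$ is $\mathbb{L}$-bilinear, and $g\mapsto B(\cdot,g)$ is an isometric isomorphism ($\mathbb{L}$-linear, bijective and norm preserving) from $\ell^q(S,Y^*)$ onto $\ell^p(S,Y)^*$. 2. The same formula defines an $\mathbb{L}$-bilinear map $B$ on $c_0(S,Y)\times\ell^1(S,Y^*)$, and $g\mapsto B(\cdot,g)$ is an isometric isomorphism from $\ell^1(S,Y^*)$ onto $c_0(S,Y)^*$. In particular, for $Y=\mathbb{L}$ (normed by the modulus), $B(f,g)=\sum_{s\in S}f(s)g(s)$ defines $\mathbb{L}$-bilinear maps on $\ell^p(S,\mathbb{L})\times\ell^q(S,\mathbb{L})$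 and on $c_0(S,\mathbb{L})\times\ell^1(S,\mathbb{L})$, and $g\mapsto B(\cdot,g)$ gives isometric isomorphisms from $\ell^q(S,\mathbb{L})$ onto $\ell^p(S,\mathbb{L})^*$ and from $\ell^1(S,\mathbb{L})$ onto $c_0(S,\mathbb{L})^*$. -/

import Mathlib

open scoped ENNReal

noncomputable section

set_option linter.unusedSectionVars false

namespace LAnalysis

open scoped Pointwise

/-! ## Dedekind complete unital f-algebras

`L` is a commutative unital ring, a real algebra, an ordered vector space and a Dedekind complete
lattice; `IsFAlgebra` is the axiom that makes such a lattice ordered algebra an f-algebra. -/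

/-- The f-algebra axiom: multiplication by a positive element preserves disjointness. -/
class IsFAlgebra (L : Type*) [CommRing L] [Lattice L] : Prop where
  mul_inf_eq_zero : ∀ a b c : L, a ⊓ b = 0 → 0 ≤ c → (c * a) ⊓ b = 0

section FAlgebra

variable {L : Type*} [CommRing L] [ConditionallyCompleteLattice L] [IsOrderedRing L] [IsFAlgebra L]

theorem le_of_sub_eq {a b c : L} (hc : 0 ≤ c) (h : b - a = c) : a ≤ b :=
  sub_nonneg.1 (h ▸ hc)

theorem mul_eq_zero_of_inf {a b : L} (h : a ⊓ b = 0) : a * b = 0 := by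
  have ha : 0 ≤ a := h ▸ inf_le_left
  have hb : 0 ≤ b := h ▸ inf_le_right
  have h1 := IsFAlgebra.mul_inf_eq_zero a b b h hb
  have h2 := IsFAlgebra.mul_inf_eq_zero b (b * a) a (by rw [inf_comm]; exact h1) ha
  rwa [mul_comm b a, inf_idem] at h2

theorem posPart_mul_negPart (a : L) : a⁺ * a⁻ = 0 :=
  mul_eq_zero_of_inf (posPart_inf_negPart_eq_zero a)

theorem abs_mul_self' (a : L) : |a| * |a| = a * a := by
  have h := posPart_mul_negPart a
  have e1 : |a| = a⁺ + a⁻ := (posPart_add_negPart a).symm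
  have e2 : a = a⁺ - a⁻ := (posPart_sub_negPart a).symm
  rw [e1]
  conv_rhs => rw [e2]
  linear_combination 4 * h

theorem self_mul_nonneg (a : L) : 0 ≤ a * a := by
  rw [← abs_mul_self']; exact mul_nonneg (abs_nonneg a) (abs_nonneg a)

theorem sub_inf_disj (a b : L) : (a - a ⊓ b) ⊓ (b - a ⊓ b) = 0 := by
  have := inf_sub a b (a ⊓ b)
  rw [sub_self] at this; exact this.symm

theorem mul_inf' {c : L} (hc : 0 ≤ c) (a b : L) : c * (a ⊓ b) = (c * a) ⊓ (c * b) := by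
  have h := sub_inf_disj a b
  have h1 := IsFAlgebra.mul_inf_eq_zero _ _ c h hc
  rw [inf_comm] at h1
  have h2 := IsFAlgebra.mul_inf_eq_zero _ _ c h1 hc
  have h3 := inf_sub (c * b) (c * a) (c * (a ⊓ b))
  rw [mul_sub, mul_sub] at h2
  rw [← h3] at h2
  rw [inf_comm (c * a)]
  exact (sub_eq_zero.1 h2).symm

theorem arch {x y : L} (h : ∀ n : ℕ, n • x ≤ y) : x ≤ 0 := by
  have hb : BddAbove (Set.range fun n : ℕ => n • x) := ⟨y, by rintro _ ⟨n, rfl⟩; exact h n⟩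
  have h1 : sSup (Set.range fun n : ℕ => n • x) ≤ sSup (Set.range fun n : ℕ => n • x) - x := by
    apply csSup_le (Set.range_nonempty _)
    rintro _ ⟨n, rfl⟩
    rw [le_sub_iff_add_le]
    have := le_csSup hb ⟨n + 1, rfl⟩
    simpa [add_smul] using this
  have := le_sub_iff_add_le.1 h1
  simpa using this

theorem nonpos_of_mul_self {d : L} (h0 : 0 ≤ d) (hd : d * d = 0) : d ≤ 0 := by
  apply arch (y := 1)
  intro n
  have h1 := self_mul_nonneg (1 - (n : L) * d)
  have h2 : (0 : L) ≤ (n : L) * d := mul_nonneg (Nat.cast_nonneg n) h0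
  rw [nsmul_eq_mul]
  exact le_of_sub_eq (add_nonneg h1 h2) (by linear_combination (-(n : L) ^ 2) * hd)

theorem sq_le_sq_imp {a b : L} (hb : 0 ≤ b) (h : a * a ≤ b * b) : a ≤ b := by
  set d := (a - b)⁺ with hd
  have h0 : 0 ≤ d := posPart_nonneg _
  have h1 : d * (a - b)⁻ = 0 := posPart_mul_negPart _
  have h2 : d - (a - b)⁻ = a - b := posPart_sub_negPart _
  have hda : d * (a - b) = d * d := by rw [← h2]; linear_combination -h1
  have h3 : d * (b * b - a * a) = -(d * d * d) - (b * (d * d) + b * (d * d)) := by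
    linear_combination (-(a + b) - d) * hda
  have h4 : 0 ≤ d * (b * b - a * a) := mul_nonneg h0 (sub_nonneg.2 h)
  have hdd : 0 ≤ d * d := mul_nonneg h0 h0
  have hbd : 0 ≤ b * (d * d) := mul_nonneg hb hdd
  have h5 : d * d * d = 0 := by
    apply le_antisymm
    · exact le_of_sub_eq (add_nonneg h4 (add_nonneg hbd hbd)) (by rw [h3]; ring)
    · exact mul_nonneg hdd h0
  have h6 : d * d = 0 :=
    le_antisymm (nonpos_of_mul_self hdd (by linear_combination d * h5)) hdd
  have h7 := nonpos_of_mul_self h0 h6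
  exact sub_nonpos.1 ((le_posPart (a - b)).trans h7)

theorem eq_of_sq_eq {a b : L} (ha : 0 ≤ a) (hb : 0 ≤ b) (h : a * a = b * b) : a = b :=
  le_antisymm (sq_le_sq_imp hb h.le) (sq_le_sq_imp ha h.ge)

theorem abs_mul' (a b : L) : |a * b| = |a| * |b| := by
  apply eq_of_sq_eq (abs_nonneg _) (mul_nonneg (abs_nonneg _) (abs_nonneg _))
  rw [abs_mul_self', mul_mul_mul_comm |a|, abs_mul_self', abs_mul_self', mul_mul_mul_comm]

theorem sub_inf_one_mul {u : L} (hu : 0 ≤ u) : (1 - u ⊓ 1) * u ≤ 1 := by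
  set m := u ⊓ 1 with hm
  have h := mul_eq_zero_of_inf (sub_inf_disj u 1)
  have h0 : 0 ≤ m := le_inf hu zero_le_one
  have h1 : m ≤ 1 := inf_le_right
  rw [← hm] at h
  exact le_of_sub_eq (add_nonneg (sub_nonneg.2 h1) (mul_nonneg h0 h0)) (by linear_combination -h)

theorem idem_nonneg {e : L} (h : e * e = e) : 0 ≤ e := h ▸ self_mul_nonneg e

theorem idem_compl {e : L} (h : e * e = e) : (1 - e) * (1 - e) = 1 - e := by
  linear_combination h

theorem idem_le_one {e : L} (h : e * e = e) : e ≤ 1 :=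
  sub_nonneg.1 (idem_nonneg (idem_compl h))

theorem idem_mul {e f : L} (h : e * e = e) (h' : f * f = f) : e * f * (e * f) = e * f := by
  linear_combination f * f * h + e * h'

theorem idem_mul_le {e x : L} (h : e * e = e) (hx : 0 ≤ x) : e * x ≤ x := by
  simpa using mul_le_mul_of_nonneg_right (idem_le_one h) hx

variable [Algebra ℝ L] [IsOrderedModule ℝ L]

theorem arch_real {x y : L} (h : ∀ ε : ℝ, 0 < ε → x ≤ ε • y) : x ≤ 0 := by
  apply arch (y := |y|)
  intro n
  rcases Nat.eq_zero_or_pos n with rfl | hn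
  · simp
  have hn' : (0 : ℝ) < n := Nat.cast_pos.2 hn
  have h1 := smul_le_smul_of_nonneg_left (h (n : ℝ)⁻¹ (inv_pos.2 hn')) hn'.le
  rw [smul_inv_smul₀ hn'.ne', Nat.cast_smul_eq_nsmul] at h1
  exact h1.trans (le_abs_self y)

theorem isLUB_mul {c : L} (hc : 0 ≤ c) {A : Set L} (hA : A.Nonempty) {s : L} (hs : IsLUB A s) :
    IsLUB ((fun x => c * x) '' A) (c * s) := by
  constructor
  · rintro _ ⟨a, ha, rfl⟩
    exact mul_le_mul_of_nonneg_left (hs.1 ha) hc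
  intro z hz
  obtain ⟨a₀, ha₀⟩ := hA
  rw [← sub_nonpos]
  apply arch_real (y := c * c * (s - a₀))
  intro ε hε
  -- `ε c ≤ 1 + ε² c²`
  have key : ∀ a ∈ A, a ≤ s + (ε • (ε • (c * c * (s - a₀)) - (c * s - z))) := by
    intro a ha
    set x := (s - a) ⊓ (s - a₀) with hx
    have hx0 : 0 ≤ x := le_inf (sub_nonneg.2 (hs.1 ha)) (sub_nonneg.2 (hs.1 ha₀))
    have h1 : c * s - z ≤ c * x := by
      rw [hx, mul_inf' hc]
      refine le_inf ?_ ?_ <;> rw [mul_sub] <;> apply sub_le_sub_left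
      · exact hz ⟨a, ha, rfl⟩
      · exact hz ⟨a₀, ha₀, rfl⟩
    have h2 : 0 ≤ (1 - ε • c) * (1 - ε • c) := self_mul_nonneg _
    have h3 : 0 ≤ ε • c := smul_nonneg hε.le hc
    have h4 : ε • c ≤ 1 + (ε • c) * (ε • c) := le_of_sub_eq (add_nonneg h2 h3) (by ring)
    have h5 : ε • (c * s - z) ≤ x + (ε • c) * (ε • c) * x :=
      calc ε • (c * s - z) ≤ ε • (c * x) := smul_le_smul_of_nonneg_left h1 hε.le
        _ = (ε • c) * x := by rw [smul_mul_assoc]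
        _ ≤ (1 + (ε • c) * (ε • c)) * x := mul_le_mul_of_nonneg_right h4 hx0
        _ = _ := by ring
    have h6 : x ≤ s - a := inf_le_left
    have h7 : (ε • c) * (ε • c) * x ≤ (ε • c) * (ε • c) * (s - a₀) :=
      mul_le_mul_of_nonneg_left inf_le_right (self_mul_nonneg _)
    have h8 := h5.trans (add_le_add h6 h7)
    have h9 : (ε • c) * (ε • c) * (s - a₀) = ε • (ε • (c * c * (s - a₀))) := by
      simp only [smul_mul_assoc, mul_smul_comm]
    rw [h9] at h8
    rw [smul_sub ε (ε • _)]
    exact le_of_sub_eq (sub_nonneg.2 h8) (by abel)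
  have h1 : s ≤ s + (ε • (ε • (c * c * (s - a₀)) - (c * s - z))) := hs.2 key
  have h2 : 0 ≤ ε • (ε • (c * c * (s - a₀)) - (c * s - z)) := by simpa using h1
  have h3 := smul_nonneg (inv_pos.2 hε).le h2
  rw [inv_smul_smul₀ hε.ne'] at h3
  exact sub_nonneg.1 h3

theorem isGLB_mul {c : L} (hc : 0 ≤ c) {A : Set L} (hA : A.Nonempty) {s : L} (hs : IsGLB A s) :
    IsGLB ((fun x => c * x) '' A) (c * s) := by
  have h := isLUB_mul hc (A := -A) (by simpa using hA) (s := -s) (isLUB_neg'.2 hs)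
  have h2 : (fun x => c * x) '' (-A) = -((fun x => c * x) '' A) := by
    ext y
    simp only [Set.mem_image, Set.mem_neg]
    constructor
    · rintro ⟨a, ha, rfl⟩; exact ⟨-a, ha, by ring⟩
    · rintro ⟨a, ha, h⟩; exact ⟨-a, by simpa using ha, by rw [mul_neg, h, neg_neg]⟩
  rw [h2, mul_neg] at h
  exact isLUB_neg'.1 h

theorem exists_inv {a : L} (ha : 1 ≤ a) : ∃ b : L, 0 ≤ b ∧ a * b = 1 := by
  have ha0 : 0 ≤ a := zero_le_one.trans ha
  set B : Set L := {x | 0 ≤ x ∧ a * x ≤ 1} with hB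
  have hne : B.Nonempty := ⟨0, le_rfl, by simp⟩
  have hbd : BddAbove B := by
    refine ⟨1, fun x hx => ?_⟩
    have := mul_le_mul_of_nonneg_right ha hx.1
    rw [one_mul] at this
    exact this.trans hx.2
  set s := sSup B with hs
  have hlub : IsLUB B s := isLUB_csSup hne hbd
  have hs0 : 0 ≤ s := hlub.1 ⟨le_rfl, by simp⟩
  have has : a * s ≤ 1 := by
    apply (isLUB_mul ha0 hne hlub).2
    rintro _ ⟨x, hx, rfl⟩
    exact hx.2
  refine ⟨s, hs0, le_antisymm has ?_⟩
  rw [← sub_nonpos]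
  have hd0 : 0 ≤ 1 - a * s := sub_nonneg.2 has
  apply arch_real (y := a * (1 - a * s))
  intro ε hε
  have hu : 0 ≤ ε • a := smul_nonneg hε.le ha0
  set w := 1 - (ε • a) ⊓ 1 with hw
  have hw0 : 0 ≤ w := sub_nonneg.2 inf_le_right
  have h1 : w * (ε • a) ≤ 1 := sub_inf_one_mul hu
  set t := ε • (w * (1 - a * s)) with ht
  have ht0 : 0 ≤ t := smul_nonneg hε.le (mul_nonneg hw0 hd0)
  have hat : a * t ≤ 1 - a * s := by
    have := mul_le_mul_of_nonneg_right h1 hd0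
    rw [one_mul] at this
    convert this using 1
    rw [ht]
    simp only [smul_mul_assoc, mul_smul_comm]
    congr 1; ring
  have h2 : s ≤ s - t := by
    apply hlub.2
    intro x hx
    rw [le_sub_iff_add_le]
    apply hlub.1
    refine ⟨add_nonneg hx.1 ht0, ?_⟩
    rw [mul_add]
    have h3 : a * x ≤ a * s := mul_le_mul_of_nonneg_left (hlub.1 hx) ha0
    exact le_of_sub_eq (add_nonneg (sub_nonneg.2 hat) (sub_nonneg.2 h3)) (by ring)
  have h3 : t ≤ 0 := by
    have := le_sub_iff_add_le.1 h2
    simpa using this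
  have h4 : w * (1 - a * s) ≤ 0 := by
    have := smul_le_smul_of_nonneg_left h3 (inv_pos.2 hε).le
    rwa [ht, inv_smul_smul₀ hε.ne', smul_zero] at this
  have h5 : 1 - ε • a ≤ w := sub_le_sub_left inf_le_left _
  have h6 := (mul_le_mul_of_nonneg_right h5 hd0).trans h4
  rw [sub_mul, one_mul, smul_mul_assoc] at h6
  exact sub_nonpos.1 h6

theorem comparison (x : L) : ∃ e : L, e * e = e ∧ 0 ≤ e * x ∧ (1 - e) * x ≤ 0 := by
  have hp : 0 ≤ x⁺ := posPart_nonneg x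
  have hm : 0 ≤ x⁻ := negPart_nonneg x
  have hpm : x⁺ * x⁻ = 0 := posPart_mul_negPart x
  have hx : x⁺ - x⁻ = x := posPart_sub_negPart x
  set A : Set L := Set.range fun n : ℕ => ((n : L) * x⁺) ⊓ 1 with hA
  have hn0 : ∀ n : ℕ, 0 ≤ (n : L) * x⁺ := fun n => mul_nonneg (Nat.cast_nonneg n) hp
  have hne : A.Nonempty := Set.range_nonempty _
  have hbd : BddAbove A := ⟨1, by rintro _ ⟨n, rfl⟩; exact inf_le_right⟩
  set e := sSup A with he
  have hlub : IsLUB A e := isLUB_csSup hne hbd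
  have he0 : 0 ≤ e := (le_inf (hn0 0) zero_le_one).trans (hlub.1 ⟨0, rfl⟩)
  have he1 : e ≤ 1 := hlub.2 (by rintro _ ⟨n, rfl⟩; exact inf_le_right)
  have hf0 : 0 ≤ 1 - e := sub_nonneg.2 he1
  have h1 : x⁻ * e = 0 := by
    apply le_antisymm _ (mul_nonneg hm he0)
    apply (isLUB_mul hm hne hlub).2
    rintro _ ⟨_, ⟨n, rfl⟩, rfl⟩
    refine (mul_le_mul_of_nonneg_left inf_le_left hm).trans (le_of_eq ?_)
    linear_combination (n : L) * hpm
  have h2 : (1 - e) * x⁺ = 0 := by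
    apply le_antisymm _ (mul_nonneg hf0 hp)
    apply arch (y := 1)
    intro n
    have h3 : 1 - e ≤ 1 - ((n : L) * x⁺) ⊓ 1 := sub_le_sub_left (hlub.1 ⟨n, rfl⟩) _
    have h4 := (mul_le_mul_of_nonneg_right h3 (hn0 n)).trans (sub_inf_one_mul (hn0 n))
    rw [nsmul_eq_mul]
    convert h4 using 1
    ring
  have h3 : (1 - e) * e = 0 := by
    apply le_antisymm _ (mul_nonneg hf0 he0)
    apply (isLUB_mul hf0 hne hlub).2
    rintro _ ⟨_, ⟨n, rfl⟩, rfl⟩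
    refine (mul_le_mul_of_nonneg_left inf_le_left hf0).trans (le_of_eq ?_)
    linear_combination (n : L) * h2
  refine ⟨e, by linear_combination -h3, ?_, ?_⟩
  · have : e * x = e * x⁺ := by
      linear_combination (-e) * hx - h1
    rw [this]; exact mul_nonneg he0 hp
  · have : (1 - e) * x = -((1 - e) * x⁻) := by
      linear_combination -(1 - e) * hx + h2
    rw [this]; exact neg_nonpos.2 (mul_nonneg hf0 hm)

theorem smul_eq_mul_one (r : ℝ) (x : L) : r • x = x * (r • (1 : L)) := by
  rw [mul_smul_comm, mul_one]

/-- To prove `z ≤ 0` one may restrict to the idempotents on which `x` lies between two consecutive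
multiples of `δ`. -/
theorem shell {x z : L} (hx : 0 ≤ x) {δ : ℝ} (hδ : 0 < δ)
    (h : ∀ (k : ℕ) (π : L), π * π = π → (k * δ) • π ≤ π * x → π * x ≤ ((k + 1) * δ) • π →
      π * z ≤ 0) : z ≤ 0 := by
  choose e he h0 h1 using fun k : ℕ => comparison ((k * δ) • (1 : L) - x)
  have h0' : ∀ k, e k * x ≤ (k * δ) • e k := fun k => by
    have := h0 k
    rw [mul_sub, ← smul_eq_mul_one] at this
    exact sub_nonneg.1 this
  have h1' : ∀ k : ℕ, (k * δ) • (1 - e k) ≤ (1 - e k) * x := fun k => by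
    have := h1 k
    rw [mul_sub, ← smul_eq_mul_one] at this
    exact sub_nonpos.1 this
  have main : ∀ N, e N * z ≤ 0 := by
    intro N
    induction N with
    | zero =>
      apply h 0 _ (he 0)
      · simpa using mul_nonneg (idem_nonneg (he 0)) hx
      · refine (h0' 0).trans ?_
        simpa using smul_nonneg hδ.le (idem_nonneg (he 0))
    | succ N ih =>
      have a1 : e (N + 1) * (e N * z) ≤ 0 :=
        mul_nonpos_of_nonneg_of_nonpos (idem_nonneg (he (N + 1))) ih
      have a2 : e (N + 1) * (1 - e N) * z ≤ 0 := by
        apply h N _ (idem_mul (he (N + 1)) (idem_compl (he N)))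
        · have := mul_le_mul_of_nonneg_left (h1' N) (idem_nonneg (he (N + 1)))
          rw [mul_smul_comm] at this
          rwa [mul_assoc]
        · have := mul_le_mul_of_nonneg_left (h0' (N + 1)) (idem_nonneg (idem_compl (he N)))
          rw [mul_smul_comm] at this
          push_cast at this
          rw [mul_comm (e (N + 1))]
          rwa [mul_assoc]
      have a3 := add_nonpos a1 a2
      have a4 : e (N + 1) * (e N * z) + e (N + 1) * (1 - e N) * z = e (N + 1) * z := by ring
      rwa [a4] at a3
  apply arch (y := δ⁻¹ • (x * |z|))
  intro N
  have b0 : 0 ≤ 1 - e N := idem_nonneg (idem_compl (he N))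
  have b1 : z ≤ (1 - e N) * |z| := by
    have c1 := mul_le_mul_of_nonneg_left (le_abs_self z) b0
    exact le_of_sub_eq (add_nonneg (sub_nonneg.2 c1) (neg_nonneg.2 (main N))) (by ring)
  have b2 : (N * δ) • (1 - e N) ≤ x := (h1' N).trans (idem_mul_le (idem_compl (he N)) hx)
  have b3 := mul_le_mul_of_nonneg_right b2 (abs_nonneg z)
  have b4 := smul_le_smul_of_nonneg_left b1 (mul_nonneg (Nat.cast_nonneg (α := ℝ) N) hδ.le)
  rw [smul_mul_assoc] at b3
  have b5 := smul_le_smul_of_nonneg_left (b4.trans b3) (inv_pos.2 hδ).le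
  rwa [smul_smul, mul_comm (N : ℝ), inv_mul_cancel_left₀ hδ.ne', Nat.cast_smul_eq_nsmul] at b5

/-! ## Powers -/

/-- The power `x ^ p` of a positive element `x` for real `p ≥ 0`: the supremum of the elements
`a ^ p • e`, where `a ≥ 0` is a real number and `e` an idempotent with `a • e ≤ x`. When `L` is
represented by continuous functions, idempotents are indicators of clopen sets and this is the
continuous function that is equal to `x(ω) ^ p` wherever `x(ω)` is finite. -/
def rpow (x : L) (p : ℝ) : L :=
  sSup {y | ∃ (a : ℝ) (e : L), 0 ≤ a ∧ e * e = e ∧ a • e ≤ x ∧ y = a ^ p • e}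

theorem rpow_set_nonempty {x : L} (hx : 0 ≤ x) (p : ℝ) :
    {y | ∃ (a : ℝ) (e : L), 0 ≤ a ∧ e * e = e ∧ a • e ≤ x ∧ y = a ^ p • e}.Nonempty :=
  ⟨0, 0, 0, le_rfl, by simp, by simpa using hx, by simp⟩

theorem rpow_le_one_add {a p : ℝ} (ha : 0 ≤ a) (hp : 0 ≤ p) {n : ℕ} (hn : p ≤ n) :
    a ^ p ≤ 1 + a ^ n := by
  rcases le_total a 1 with h | h
  · have := Real.rpow_le_one ha h hp
    have := pow_nonneg ha n
    linarith
  · have := Real.rpow_le_rpow_of_exponent_le h hn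
    rw [Real.rpow_natCast] at this
    linarith

theorem rpow_set_bddAbove {x : L} {p : ℝ} (hp : 0 ≤ p) :
    BddAbove {y | ∃ (a : ℝ) (e : L), 0 ≤ a ∧ e * e = e ∧ a • e ≤ x ∧ y = a ^ p • e} := by
  obtain ⟨n, hn⟩ := exists_nat_ge p
  have hn' : p ≤ (n + 1 : ℕ) := hn.trans (by push_cast; linarith)
  refine ⟨1 + x ^ (n + 1), ?_⟩
  rintro _ ⟨a, e, ha, he, hae, rfl⟩
  have he0 := idem_nonneg he
  have h1 : a ^ (n + 1) • e ≤ x ^ (n + 1) := by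
    have h := pow_le_pow_left₀ (smul_nonneg ha he0) hae (n + 1)
    rwa [smul_pow, IsIdempotentElem.pow_succ_eq n he] at h
  calc a ^ p • e ≤ (1 + a ^ (n + 1)) • e :=
        smul_le_smul_of_nonneg_right (rpow_le_one_add ha hp hn') he0
    _ = e + a ^ (n + 1) • e := by rw [add_smul, one_smul]
    _ ≤ _ := add_le_add (idem_le_one he) h1

theorem rpow_isLUB {x : L} (hx : 0 ≤ x) {p : ℝ} (hp : 0 ≤ p) :
    IsLUB {y | ∃ (a : ℝ) (e : L), 0 ≤ a ∧ e * e = e ∧ a • e ≤ x ∧ y = a ^ p • e} (rpow x p) :=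
  isLUB_csSup (rpow_set_nonempty hx p) (rpow_set_bddAbove hp)

theorem le_rpow {x : L} (hx : 0 ≤ x) {p : ℝ} (hp : 0 ≤ p) {a : ℝ} {e : L} (ha : 0 ≤ a)
    (he : e * e = e) (h : a • e ≤ x) : a ^ p • e ≤ rpow x p :=
  (rpow_isLUB hx hp).1 ⟨a, e, ha, he, h, rfl⟩

theorem rpow_le {x : L} (hx : 0 ≤ x) {p : ℝ} (hp : 0 ≤ p) {z : L}
    (h : ∀ (a : ℝ) (e : L), 0 ≤ a → e * e = e → a • e ≤ x → a ^ p • e ≤ z) : rpow x p ≤ z := by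
  apply (rpow_isLUB hx hp).2
  rintro _ ⟨a, e, ha, he, hae, rfl⟩
  exact h a e ha he hae

theorem rpow_nonneg {x : L} (hx : 0 ≤ x) {p : ℝ} (hp : 0 ≤ p) : 0 ≤ rpow x p := by
  have := le_rpow hx hp (a := 0) (e := 0) le_rfl (by simp) (by simpa using hx)
  simpa using this

theorem rpow_mono {x y : L} (hx : 0 ≤ x) (hxy : x ≤ y) {p : ℝ} (hp : 0 ≤ p) :
    rpow x p ≤ rpow y p :=
  rpow_le hx hp fun _ _ ha he h => le_rpow (hx.trans hxy) hp ha he (h.trans hxy)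

theorem rpow_zero_left {p : ℝ} (hp : 0 < p) : rpow (0 : L) p = 0 := by
  apply le_antisymm _ (rpow_nonneg le_rfl hp.le)
  apply rpow_le le_rfl hp.le
  intro a e ha he h
  have h1 : a • e = 0 := le_antisymm h (smul_nonneg ha (idem_nonneg he))
  rcases ha.eq_or_lt with rfl | ha
  · simp [Real.zero_rpow hp.ne']
  · have : e = 0 := by
      have := congrArg (fun y => a⁻¹ • y) h1
      simpa [inv_smul_smul₀ ha.ne'] using this
    simp [this]

theorem rpow_add_le {x y : L} (hx : 0 ≤ x) (hy : 0 ≤ y) {p : ℝ} (hp : 0 ≤ p) :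
    rpow (x + y) p ≤ (2 : ℝ) ^ p • (rpow x p + rpow y p) := by
  apply rpow_le (add_nonneg hx hy) hp
  intro a e ha he h
  have he0 := idem_nonneg he
  obtain ⟨f, hf, f1, f2⟩ := comparison (x - (a / 2) • (1 : L))
  have hf0 := idem_nonneg hf
  have hg := idem_compl hf
  have hg0 := idem_nonneg hg
  rw [mul_sub, ← smul_eq_mul_one] at f1 f2
  have a2 : 0 ≤ a / 2 := by positivity
  have h1 : (a / 2) • (e * f) ≤ x := by
    have := mul_le_mul_of_nonneg_left (sub_nonneg.1 f1) he0
    rw [mul_smul_comm] at this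
    exact this.trans ((idem_mul_le he (mul_nonneg hf0 hx)).trans (idem_mul_le hf hx))
  have h2 : (a / 2) • (e * (1 - f)) ≤ y := by
    have k1 := mul_le_mul_of_nonneg_left (sub_nonpos.1 f2) he0
    have k2 := mul_le_mul_of_nonneg_left h (mul_nonneg he0 hg0)
    rw [mul_smul_comm] at k1
    have k3 : e * (1 - f) * (a • e) = (a / 2) • (e * (1 - f)) + (a / 2) • (e * (1 - f)) := by
      rw [← add_smul, mul_smul_comm, add_halves]
      congr 1
      linear_combination (1 - f) * he
    rw [k3] at k2
    have k4 : (a / 2) • (e * (1 - f)) ≤ e * (1 - f) * y :=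
      le_of_sub_eq (add_nonneg (sub_nonneg.2 k1) (sub_nonneg.2 k2)) (by ring)
    exact k4.trans (idem_mul_le (idem_mul he hg) hy)
  have h3 := le_rpow hx hp a2 (idem_mul he hf) h1
  have h4 := le_rpow hy hp a2 (idem_mul he hg) h2
  have h5 := smul_le_smul_of_nonneg_left (add_le_add h3 h4)
    (Real.rpow_nonneg (zero_le_two (α := ℝ)) p)
  convert h5 using 1
  rw [← smul_add, smul_smul, ← Real.mul_rpow zero_le_two a2, mul_div_cancel₀ a two_ne_zero]
  congr 1
  ring

theorem rpow_mul_le {c x : L} (hc : 0 ≤ c) (hx : 0 ≤ x) {p : ℝ} (hp : 0 ≤ p) {n : ℕ}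
    (hn : p ≤ n) : rpow (c * x) p ≤ (c + 1) ^ n * rpow x p := by
  apply rpow_le (mul_nonneg hc hx) hp
  intro a e ha he h
  rw [← sub_nonpos]
  apply shell hc one_pos
  intro k π hπ h1 h2
  rw [mul_one] at h1 h2
  have hπ0 := idem_nonneg hπ
  have hk : (0 : ℝ) < k + 1 := by positivity
  have hX := rpow_nonneg hx hp
  have g1 : (a / (k + 1)) • (π * e) ≤ x := by
    have k1 := mul_le_mul_of_nonneg_left h hπ0
    have k2 := mul_le_mul_of_nonneg_right h2 hx
    rw [mul_smul_comm] at k1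
    rw [smul_mul_assoc, mul_assoc] at k2
    have k3 := k1.trans (k2.trans (smul_le_smul_of_nonneg_left (idem_mul_le hπ hx) hk.le))
    have k4 := smul_le_smul_of_nonneg_left k3 (inv_pos.2 hk).le
    rwa [inv_smul_smul₀ hk.ne', smul_smul, inv_mul_eq_div] at k4
  have g2 := le_rpow hx hp (by positivity) (idem_mul hπ he) g1
  have g3 : a ^ p • (π * e) ≤ ((k : ℝ) + 1) ^ p • (π * rpow x p) := by
    have := smul_le_smul_of_nonneg_left (mul_le_mul_of_nonneg_left g2 hπ0)
      (Real.rpow_nonneg hk.le p)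
    rw [mul_smul_comm, smul_smul, ← Real.mul_rpow hk.le (by positivity),
      mul_div_cancel₀ a hk.ne', ← mul_assoc, hπ] at this
    exact this
  have g4 : ((k : ℝ) + 1) ^ p ≤ ((k : ℝ) + 1) ^ n := by
    rw [← Real.rpow_natCast]
    exact Real.rpow_le_rpow_of_exponent_le (by simp) hn
  have g5 : ∀ m : ℕ, ((k : ℝ) + 1) ^ m • π ≤ π * (c + 1) ^ m := by
    intro m
    induction m with
    | zero => simp
    | succ m ih =>
      have q1 : ((k : ℝ) + 1) • π ≤ π * (c + 1) := by
        rw [add_smul, one_smul, mul_add, mul_one]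
        exact add_le_add_left h1 π
      have q2 := mul_le_mul ih q1 (smul_nonneg hk.le hπ0)
        (mul_nonneg hπ0 (pow_nonneg (add_nonneg hc zero_le_one) m))
      rw [smul_mul_smul_comm, hπ, ← pow_succ] at q2
      convert q2 using 1
      linear_combination (-(c + 1) ^ (m + 1)) * hπ
  have g6 : ((k : ℝ) + 1) ^ n • (π * rpow x p) ≤ π * (c + 1) ^ n * rpow x p := by
    have := mul_le_mul_of_nonneg_right (g5 n) hX
    rwa [smul_mul_assoc] at this
  have g7 := g3.trans ((smul_le_smul_of_nonneg_right g4 (mul_nonneg hπ0 hX)).trans g6)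
  rw [mul_sub, mul_smul_comm, sub_nonpos, ← mul_assoc]
  exact g7

theorem rpow_half_mul_self {x : L} (hx : 0 ≤ x) : rpow x (1 / 2) * rpow x (1 / 2) = x := by
  have hh : (0 : ℝ) ≤ 1 / 2 := by norm_num
  have hlub := rpow_isLUB hx hh
  have hne := rpow_set_nonempty hx (1 / 2)
  have hs0 := rpow_nonneg hx hh
  have aux : ∀ (a b : ℝ) (e f : L), 0 ≤ a → 0 ≤ b → e * e = e → f * f = f → b • f ≤ x → a ≤ b →
      (a ^ (1 / 2 : ℝ) • e) * (b ^ (1 / 2 : ℝ) • f) ≤ x := by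
    intro a b e f ha hb he hf h hab
    have h1 : a ^ (1 / 2 : ℝ) * b ^ (1 / 2 : ℝ) ≤ b := by
      calc a ^ (1 / 2 : ℝ) * b ^ (1 / 2 : ℝ) ≤ b ^ (1 / 2 : ℝ) * b ^ (1 / 2 : ℝ) := by
            gcongr
        _ = b := by rw [← Real.sqrt_eq_rpow, Real.mul_self_sqrt hb]
    rw [smul_mul_smul_comm]
    calc _ ≤ b • (e * f) :=
          smul_le_smul_of_nonneg_right h1 (mul_nonneg (idem_nonneg he) (idem_nonneg hf))
      _ = e * (b • f) := by rw [mul_smul_comm]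
      _ ≤ e * x := mul_le_mul_of_nonneg_left h (idem_nonneg he)
      _ ≤ x := idem_mul_le he hx
  apply le_antisymm
  · apply (isLUB_mul hs0 hne hlub).2
    rintro _ ⟨_, ⟨a, e, ha, he, hae, rfl⟩, rfl⟩
    have hy : 0 ≤ a ^ (1 / 2 : ℝ) • e := smul_nonneg (Real.rpow_nonneg ha _) (idem_nonneg he)
    simp only
    rw [mul_comm]
    apply (isLUB_mul hy hne hlub).2
    rintro _ ⟨_, ⟨b, f, hb, hf, hbf, rfl⟩, rfl⟩
    rcases le_total a b with hab | hab
    · exact aux a b e f ha hb he hf hbf hab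
    · simp only
      rw [mul_comm]
      exact aux b a f e hb ha hf he hae hab
  · rw [← sub_nonpos]
    apply arch_real (y := 1)
    intro δ hδ
    rw [← sub_nonpos]
    apply shell hx hδ
    intro k π hπ h1 h2
    have hπ0 := idem_nonneg hπ
    have hk : (0 : ℝ) ≤ k * δ := by positivity
    have g1 := le_rpow hx hh hk hπ (h1.trans (idem_mul_le hπ hx))
    have g2 := mul_le_mul g1 g1 (smul_nonneg (Real.rpow_nonneg hk _) hπ0) hs0
    rw [smul_mul_smul_comm, hπ, ← Real.sqrt_eq_rpow, Real.mul_self_sqrt hk] at g2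
    have g3 := mul_le_mul_of_nonneg_left g2 hπ0
    rw [mul_smul_comm, hπ] at g3
    have g4 : π * (x - rpow x (1 / 2) * rpow x (1 / 2) - δ • 1) ≤
        ((k + 1) * δ) • π - (k * δ) • π - δ • π := by
      rw [mul_sub, mul_sub, ← smul_eq_mul_one]
      exact sub_le_sub_right (sub_le_sub h2 g3) _
    refine g4.trans (le_of_eq ?_)
    rw [← sub_smul, ← sub_smul]
    ring_nf
    simp

/-! ## Real and complex scalars, modulus -/

end FAlgebra

/-- Whether the scalars are the real f-algebra `L` itself or its complexification `L + iL`. -/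
inductive ScalarKind
  | real
  | complex

/-- The scalars: `L`, or the complexification `L + iL` with `i ^ 2 = -1`. -/
def Scalar (L : Type*) [CommRing L] : ScalarKind → Type _
  | .real => L
  | .complex => QuadraticAlgebra L (-1) 0

instance (L : Type*) [CommRing L] : (k : ScalarKind) → CommRing (Scalar L k)
  | .real => inferInstanceAs (CommRing L)
  | .complex => inferInstanceAs (CommRing (QuadraticAlgebra L (-1) 0))

section Norms

variable (L : Type*) [CommRing L] [ConditionallyCompleteLattice L] [IsOrderedRing L] [IsFAlgebra L]
  [Algebra ℝ L] [IsOrderedModule ℝ L] (k : ScalarKind)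

/-- The modulus: `|x|` for real scalars, `√(x² + y²)` for the complex scalar `x + iy`. -/
def modulus : (k : ScalarKind) → Scalar L k → L
  | .real => fun x : L => |x|
  | .complex => fun z : QuadraticAlgebra L (-1) 0 => rpow (z.re * z.re + z.im * z.im) (1 / 2)

variable {L}

theorem sumsq_nonneg (a b : L) : 0 ≤ a * a + b * b :=
  add_nonneg (self_mul_nonneg a) (self_mul_nonneg b)

theorem root_sq (a b : L) : rpow (a * a + b * b) (1 / 2) * rpow (a * a + b * b) (1 / 2) =
    a * a + b * b := rpow_half_mul_self (sumsq_nonneg a b)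

theorem root_nonneg (a b : L) : 0 ≤ rpow (a * a + b * b) (1 / 2) :=
  rpow_nonneg (sumsq_nonneg a b) (by norm_num)

theorem eq_zero_of_abs {x : L} (h : |x| = 0) : x = 0 :=
  le_antisymm (h ▸ le_abs_self x) (neg_nonpos.1 (h ▸ neg_le_abs x))

theorem modulus_zero : modulus L k 0 = 0 := by
  cases k with
  | real => exact abs_zero (α := L)
  | complex =>
    have h : rpow ((0 : QuadraticAlgebra L (-1) 0).re * (0 : QuadraticAlgebra L (-1) 0).re +
        (0 : QuadraticAlgebra L (-1) 0).im * (0 : QuadraticAlgebra L (-1) 0).im) (1 / 2) = 0 := by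
      simpa using rpow_zero_left (L := L) (p := 1 / 2) (by norm_num)
    exact h

theorem modulus_nonneg (x : Scalar L k) : 0 ≤ modulus L k x := by
  cases k with
  | real => exact abs_nonneg (α := L) x
  | complex => exact root_nonneg _ _

theorem modulus_mul (x y : Scalar L k) :
    modulus L k (x * y) = modulus L k x * modulus L k y := by
  cases k with
  | real => exact abs_mul' (L := L) x y
  | complex =>
    apply eq_of_sq_eq (modulus_nonneg _ _) (mul_nonneg (modulus_nonneg _ _) (modulus_nonneg _ _))
    rw [mul_mul_mul_comm]
    have key : ∀ z w : QuadraticAlgebra L (-1) 0,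
        rpow ((z * w).re * (z * w).re + (z * w).im * (z * w).im) (1 / 2) *
          rpow ((z * w).re * (z * w).re + (z * w).im * (z * w).im) (1 / 2) =
        rpow (z.re * z.re + z.im * z.im) (1 / 2) * rpow (z.re * z.re + z.im * z.im) (1 / 2) *
        (rpow (w.re * w.re + w.im * w.im) (1 / 2) * rpow (w.re * w.re + w.im * w.im) (1 / 2)) := by
      intro z w
      rw [root_sq, root_sq, root_sq, QuadraticAlgebra.re_mul, QuadraticAlgebra.im_mul]
      ring
    exact key x y

theorem modulus_add_le (x y : Scalar L k) :
    modulus L k (x + y) ≤ modulus L k x + modulus L k y := by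
  cases k with
  | real => exact abs_add_le (α := L) x y
  | complex =>
    apply sq_le_sq_imp (add_nonneg (modulus_nonneg _ _) (modulus_nonneg _ _))
    have key : ∀ z w : QuadraticAlgebra L (-1) 0,
        rpow ((z + w).re * (z + w).re + (z + w).im * (z + w).im) (1 / 2) *
          rpow ((z + w).re * (z + w).re + (z + w).im * (z + w).im) (1 / 2) ≤
        (rpow (z.re * z.re + z.im * z.im) (1 / 2) + rpow (w.re * w.re + w.im * w.im) (1 / 2)) *
        (rpow (z.re * z.re + z.im * z.im) (1 / 2) + rpow (w.re * w.re + w.im * w.im) (1 / 2)) := by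
      intro z w
      rw [root_sq, QuadraticAlgebra.re_add, QuadraticAlgebra.im_add]
      have hz := root_sq z.re z.im
      have hw := root_sq w.re w.im
      have hz0 := root_nonneg z.re z.im
      have hw0 := root_nonneg w.re w.im
      set u := rpow (z.re * z.re + z.im * z.im) (1 / 2)
      set v := rpow (w.re * w.re + w.im * w.im) (1 / 2)
      have h1 : z.re * w.re + z.im * w.im ≤ u * v := by
        apply sq_le_sq_imp (mul_nonneg hz0 hw0)
        apply le_of_sub_eq (self_mul_nonneg (z.re * w.im - z.im * w.re))
        linear_combination (v * v) * hz + (z.re * z.re + z.im * z.im) * hw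
      have h2 := sub_nonneg.2 h1
      apply le_of_sub_eq (add_nonneg h2 h2)
      linear_combination hz + hw
    exact key x y

theorem eq_zero_of_modulus (x : Scalar L k) (h : modulus L k x = 0) : x = 0 := by
  cases k with
  | real => exact eq_zero_of_abs (L := L) h
  | complex =>
    have key : ∀ z : QuadraticAlgebra L (-1) 0,
        rpow (z.re * z.re + z.im * z.im) (1 / 2) = 0 → z = 0 := by
      intro z hz
      have h1 := root_sq z.re z.im
      rw [hz, mul_zero] at h1
      have a0 := self_mul_nonneg z.re
      have b0 := self_mul_nonneg z.im
      have a1 : z.re * z.re = 0 :=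
        le_antisymm (le_of_sub_eq b0 (by linear_combination h1)) a0
      have b1 : z.im * z.im = 0 :=
        le_antisymm (le_of_sub_eq a0 (by linear_combination h1)) b0
      have nil : ∀ t : L, t * t = 0 → t = 0 := fun t ht => by
        have := nonpos_of_mul_self (abs_nonneg t) (by rw [abs_mul_self', ht])
        exact eq_zero_of_abs (le_antisymm this (abs_nonneg t))
      exact QuadraticAlgebra.ext (nil _ a1) (nil _ b1)
    exact key x h

/-! ## `L`-normed spaces, convergence and the dual space -/

/-- A function `X → L` that is used as the norm of `X`. -/
class LNorm (L : Type*) (X : Type*) where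
  /-- The `L`-valued norm. -/
  val : X → L

variable (L)

/-- The `L`-valued norm of an element of `X`. -/
def lnorm {X : Type*} [LNorm L X] (x : X) : L := LNorm.val x

instance : LNorm L L := ⟨fun x => |x|⟩

instance : LNorm L (Scalar L k) := ⟨modulus L k⟩

/-- `X` is an `L`-normed space. -/
class IsLNormedSpace (X : Type*) [AddCommGroup X] [Module (Scalar L k) X] [LNorm L X] : Prop where
  nonneg : ∀ x : X, 0 ≤ lnorm L x
  smul : ∀ (c : Scalar L k) (x : X), lnorm L (c • x) = modulus L k c * lnorm L x
  add_le : ∀ x y : X, lnorm L (x + y) ≤ lnorm L x + lnorm L y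
  eq_zero : ∀ x : X, lnorm L x = 0 → x = 0

instance : IsLNormedSpace L k (Scalar L k) where
  nonneg := modulus_nonneg k
  smul := modulus_mul k
  add_le := modulus_add_le k
  eq_zero := eq_zero_of_modulus k

/-- Convergence of a net in an `L`-normed space; `IsGLB E 0` says `E ⊆ L⁺` and `inf E = 0`. -/
def LConverges {X : Type*} [AddCommGroup X] [LNorm L X] {I : Type*} [Preorder I] (u : I → X)
    (x : X) : Prop :=
  ∃ E : Set L, IsGLB E 0 ∧ ∀ ε ∈ E, ∃ i₀, ∀ i, i₀ ≤ i → lnorm L (u i - x) ≤ ε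

/-- The series `∑ u i` converges to `x`: the net of its finite partial sums does. -/
def HasLSum {X : Type*} [AddCommGroup X] [LNorm L X] {I : Type*} (u : I → X) (x : X) : Prop :=
  LConverges L (fun F : Finset I => ∑ i ∈ F, u i) x

section Dual

variable (X : Type*) [AddCommGroup X] [Module (Scalar L k) X] [LNorm L X]

/-- `M` is a bound of the linear functional `φ`. -/
def IsBound {X : Type*} [AddCommGroup X] [Module (Scalar L k) X] [LNorm L X]
    (φ : X →ₗ[Scalar L k] Scalar L k) (M : L) : Prop :=
  0 ≤ M ∧ ∀ x, modulus L k (φ x) ≤ M * lnorm L x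

/-- The bounded linear functionals on `X`, as a submodule of the linear functionals. -/
def dualSubmodule : Submodule (Scalar L k) (X →ₗ[Scalar L k] Scalar L k) where
  carrier := {φ | ∃ M, IsBound L k φ M}
  zero_mem' := ⟨0, le_rfl, fun x => by simp [modulus_zero]⟩
  add_mem' := by
    rintro φ ψ ⟨M, hM, h⟩ ⟨N, hN, h'⟩
    refine ⟨M + N, add_nonneg hM hN, fun x => ?_⟩
    rw [add_mul]
    exact (modulus_add_le k _ _).trans (add_le_add (h x) (h' x))
  smul_mem' := by
    rintro c φ ⟨M, hM, h⟩
    refine ⟨modulus L k c * M, mul_nonneg (modulus_nonneg k c) hM, fun x => ?_⟩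
    rw [mul_assoc]
    exact (modulus_mul k _ _).le.trans (mul_le_mul_of_nonneg_left (h x) (modulus_nonneg k c))

/-- The dual space of `X`: the space of bounded linear functionals. -/
def Dual : Type _ := dualSubmodule L k X

instance : AddCommGroup (Dual L k X) := inferInstanceAs (AddCommGroup (dualSubmodule L k X))

instance : Module (Scalar L k) (Dual L k X) :=
  inferInstanceAs (Module (Scalar L k) (dualSubmodule L k X))

instance : FunLike (Dual L k X) X (Scalar L k) where
  coe φ := φ.1
  coe_injective _ _ h := Subtype.ext (DFunLike.coe_injective h)

/-- The norm of a bounded functional is the infimum of its bounds. -/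
instance : LNorm L (Dual L k X) := ⟨fun φ => sInf {M | IsBound L k φ.1 M}⟩

variable {L X}

theorem isBound_bddBelow (φ : X →ₗ[Scalar L k] Scalar L k) : BddBelow {M | IsBound L k φ M} :=
  ⟨0, fun _ h => h.1⟩

theorem lnorm_dual_isGLB (φ : Dual L k X) : IsGLB {M | IsBound L k φ.1 M} (lnorm L φ) :=
  isGLB_csInf φ.2 (isBound_bddBelow k φ.1)

variable [IsLNormedSpace L k X]

theorem isBound_lnorm (φ : Dual L k X) : IsBound L k φ.1 (lnorm L φ) := by
  have h := lnorm_dual_isGLB k φ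
  refine ⟨h.2 fun M hM => hM.1, fun x => ?_⟩
  rw [mul_comm]
  apply (isGLB_mul (IsLNormedSpace.nonneg k x) φ.2 h).2
  rintro _ ⟨M, hM, rfl⟩
  simp only
  rw [mul_comm]
  exact hM.2 x

instance : IsLNormedSpace L k (Dual L k X) where
  nonneg φ := (isBound_lnorm k φ).1
  smul c φ := by
    have hφ := isBound_lnorm k φ
    have hc := modulus_nonneg k c
    have hcφ := isBound_lnorm k (c • φ)
    have e : ∀ x, modulus L k ((c • φ).1 x) = modulus L k c * modulus L k (φ.1 x) :=
      fun x => modulus_mul k _ _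
    apply le_antisymm
    · apply (lnorm_dual_isGLB k (c • φ)).1
      refine ⟨mul_nonneg hc hφ.1, fun x => ?_⟩
      rw [e, mul_assoc]
      exact mul_le_mul_of_nonneg_left (hφ.2 x) hc
    · obtain ⟨b, hb0, hb⟩ := exists_inv (L := L) (a := modulus L k c + 1) (by simpa using hc)
      have h1 : lnorm L φ ≤ b * (lnorm L (c • φ) + lnorm L φ) := by
        apply (lnorm_dual_isGLB k φ).1
        refine ⟨mul_nonneg hb0 (add_nonneg hcφ.1 hφ.1), fun x => ?_⟩
        have h2 := hcφ.2 x
        rw [e] at h2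
        have h3 := mul_le_mul_of_nonneg_left (add_le_add h2 (hφ.2 x)) hb0
        calc modulus L k (φ.1 x) = b * (modulus L k c * modulus L k (φ.1 x) +
              modulus L k (φ.1 x)) := by linear_combination (-modulus L k (φ.1 x)) * hb
          _ ≤ _ := h3
          _ = _ := by ring
      have h2 := mul_le_mul_of_nonneg_left h1 (add_nonneg hc zero_le_one)
      rw [← mul_assoc, hb] at h2
      exact le_of_sub_eq (sub_nonneg.2 h2) (by ring)
  add_le φ ψ := by
    have hφ := isBound_lnorm k φ
    have hψ := isBound_lnorm k ψ
    apply (lnorm_dual_isGLB k (φ + ψ)).1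
    refine ⟨add_nonneg hφ.1 hψ.1, fun x => ?_⟩
    rw [add_mul]
    exact (modulus_add_le k _ _).trans (add_le_add (hφ.2 x) (hψ.2 x))
  eq_zero φ h := by
    apply Subtype.ext
    apply LinearMap.ext
    intro x
    apply eq_zero_of_modulus k
    have := (isBound_lnorm k φ).2 x
    rw [h, zero_mul] at this
    exact le_antisymm this (modulus_nonneg k _)

end Dual

/-! ## Series of positive terms -/

variable {L}

/-- For positive terms, the sum of a series is the supremum of the finite partial sums. -/
theorem hasLSum_iff_isLUB {I : Type*} {u : I → L} (hu : ∀ i, 0 ≤ u i) (σ : L) :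
    HasLSum L u σ ↔ IsLUB (Set.range fun F : Finset I => ∑ i ∈ F, u i) σ := by
  have mono : ∀ F G : Finset I, F ≤ G → ∑ i ∈ F, u i ≤ ∑ i ∈ G, u i := fun F G h =>
    Finset.sum_le_sum_of_subset_of_nonneg h fun i _ _ => hu i
  constructor
  · rintro ⟨E, hE, h⟩
    have h' : ∀ ε ∈ E, ∃ F₀, ∀ F, F₀ ≤ F →
        ∑ i ∈ F, u i - σ ≤ ε ∧ -(∑ i ∈ F, u i - σ) ≤ ε := fun ε hε => by
      obtain ⟨F₀, hF⟩ := h ε hε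
      exact ⟨F₀, fun F hF' => ⟨(le_abs_self _).trans (hF F hF'), (neg_le_abs _).trans (hF F hF')⟩⟩
    constructor
    · rintro _ ⟨F, rfl⟩
      rw [← sub_nonpos]
      apply hE.2
      intro ε hε
      classical
      obtain ⟨F₀, hF⟩ := h' ε hε
      exact (sub_le_sub_right (mono F (F₀ ∪ F) Finset.subset_union_right) σ).trans
        (hF _ Finset.subset_union_left).1
    · intro z hz
      rw [← sub_nonpos]
      apply hE.2
      intro ε hε
      obtain ⟨F₀, hF⟩ := h' ε hε
      have h1 := (hF F₀ le_rfl).2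
      rw [neg_sub] at h1
      exact (sub_le_sub_left (hz ⟨F₀, rfl⟩) σ).trans h1
  · intro h
    refine ⟨Set.range fun F : Finset I => σ - ∑ i ∈ F, u i, ⟨?_, ?_⟩, ?_⟩
    · rintro _ ⟨F, rfl⟩
      exact sub_nonneg.2 (h.1 ⟨F, rfl⟩)
    · intro z hz
      have : σ ≤ σ - z := by
        apply h.2
        rintro _ ⟨F, rfl⟩
        exact le_sub_comm.1 (hz ⟨F, rfl⟩)
      simpa using le_sub_iff_add_le.1 this
    · rintro _ ⟨F₀, rfl⟩
      refine ⟨F₀, fun F hF => ?_⟩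
      have h1 := h.1 ⟨F, rfl⟩
      change |∑ i ∈ F, u i - σ| ≤ _
      rw [abs_sub_comm, abs_of_nonneg (sub_nonneg.2 h1)]
      exact sub_le_sub_left (mono F₀ F hF) σ

theorem summable_iff_bddAbove {I : Type*} {u : I → L} (hu : ∀ i, 0 ≤ u i) :
    (∃ σ, HasLSum L u σ) ↔ BddAbove (Set.range fun F : Finset I => ∑ i ∈ F, u i) := by
  simp only [hasLSum_iff_isLUB hu]
  exact ⟨fun ⟨σ, h⟩ => ⟨σ, h.1⟩, fun h => ⟨_, isLUB_csSup (Set.range_nonempty _) h⟩⟩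

/-! ## The spaces `ℓ^p(S, Y)` and `c₀(S, Y)` -/

variable (L)

section Sequence

variable (S : Type*) (Y : Type*) [AddCommGroup Y] [Module (Scalar L k) Y] [LNorm L Y]
  [IsLNormedSpace L k Y]

/-- `‖f‖_p` exists: for `p = ∞` the norms `‖f s‖` have an upper bound, and for `p < ∞` the series
`∑ ‖f s‖ ^ p` converges in `L`. -/
def Memlp {S Y : Type*} [LNorm L Y] (p : ℝ≥0∞) (f : S → Y) : Prop :=
  (p = ∞ → ∃ M : L, 0 ≤ M ∧ ∀ s, lnorm L (f s) ≤ M) ∧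
  (p ≠ ∞ → ∃ σ : L, HasLSum L (fun s => rpow (lnorm L (f s)) p.toReal) σ)

/-- `ℓ^p(S, Y)` for `1 ≤ p ≤ ∞`. -/
def lp (p : ℝ≥0∞) [hp : Fact (1 ≤ p)] : Submodule (Scalar L k) (S → Y) where
  carrier := {f | Memlp L p f}
  zero_mem' := by
    have h0 : lnorm L (0 : Y) = 0 := by
      have := IsLNormedSpace.smul (L := L) (0 : Scalar L k) (0 : Y)
      rwa [zero_smul, modulus_zero, zero_mul] at this
    refine ⟨fun _ => ⟨0, le_rfl, fun s => h0.le⟩, fun h => ?_⟩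
    have hp0 : 0 < p.toReal := ENNReal.toReal_pos (one_pos.trans_le hp.1).ne' h
    have : ∀ s : S, rpow (lnorm L ((0 : S → Y) s)) p.toReal = 0 := fun s => by
      rw [Pi.zero_apply, h0, rpow_zero_left hp0]
    rw [summable_iff_bddAbove fun s => (this s).ge]
    exact ⟨0, by rintro _ ⟨F, rfl⟩; exact (Finset.sum_eq_zero fun s _ => this s).le⟩
  add_mem' := by
    intro f g hf hg
    have h0 := IsLNormedSpace.nonneg (L := L) (X := Y) k
    refine ⟨fun h => ?_, fun h => ?_⟩
    · obtain ⟨M, hM, h1⟩ := hf.1 h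
      obtain ⟨N, hN, h2⟩ := hg.1 h
      exact ⟨M + N, add_nonneg hM hN, fun s =>
        (IsLNormedSpace.add_le k _ _).trans (add_le_add (h1 s) (h2 s))⟩
    · have hp0 : 0 ≤ p.toReal := ENNReal.toReal_nonneg
      have hr : ∀ (f : S → Y) s, 0 ≤ rpow (lnorm L (f s)) p.toReal :=
        fun f s => rpow_nonneg (h0 _) hp0
      have hf' := hf.2 h
      have hg' := hg.2 h
      rw [summable_iff_bddAbove (hr _)] at hf' hg' ⊢
      obtain ⟨M, hM⟩ := hf'
      obtain ⟨N, hN⟩ := hg'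
      refine ⟨(2 : ℝ) ^ p.toReal • (M + N), ?_⟩
      rintro _ ⟨F, rfl⟩
      calc ∑ s ∈ F, rpow (lnorm L ((f + g) s)) p.toReal
          ≤ ∑ s ∈ F, (2 : ℝ) ^ p.toReal •
              (rpow (lnorm L (f s)) p.toReal + rpow (lnorm L (g s)) p.toReal) :=
            Finset.sum_le_sum fun s _ =>
              (rpow_mono (h0 _) (IsLNormedSpace.add_le k _ _) hp0).trans
                (rpow_add_le (h0 _) (h0 _) hp0)
        _ = (2 : ℝ) ^ p.toReal • (∑ s ∈ F, rpow (lnorm L (f s)) p.toReal +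
              ∑ s ∈ F, rpow (lnorm L (g s)) p.toReal) := by
            rw [← Finset.smul_sum, Finset.sum_add_distrib]
        _ ≤ _ := smul_le_smul_of_nonneg_left (add_le_add (hM ⟨F, rfl⟩) (hN ⟨F, rfl⟩))
            (Real.rpow_nonneg zero_le_two _)
  smul_mem' := by
    intro c f hf
    have h0 := IsLNormedSpace.nonneg (L := L) (X := Y) k
    have hc := modulus_nonneg k c
    refine ⟨fun h => ?_, fun h => ?_⟩
    · obtain ⟨M, hM, h1⟩ := hf.1 h
      exact ⟨modulus L k c * M, mul_nonneg hc hM, fun s =>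
        (IsLNormedSpace.smul c (f s)).le.trans (mul_le_mul_of_nonneg_left (h1 s) hc)⟩
    · have hp0 : 0 ≤ p.toReal := ENNReal.toReal_nonneg
      have hr : ∀ (f : S → Y) s, 0 ≤ rpow (lnorm L (f s)) p.toReal :=
        fun f s => rpow_nonneg (h0 _) hp0
      have hf' := hf.2 h
      rw [summable_iff_bddAbove (hr _)] at hf' ⊢
      obtain ⟨M, hM⟩ := hf'
      obtain ⟨n, hn⟩ := exists_nat_ge p.toReal
      refine ⟨(modulus L k c + 1) ^ n * M, ?_⟩
      rintro _ ⟨F, rfl⟩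
      calc ∑ s ∈ F, rpow (lnorm L ((c • f) s)) p.toReal
          ≤ ∑ s ∈ F, (modulus L k c + 1) ^ n * rpow (lnorm L (f s)) p.toReal :=
            Finset.sum_le_sum fun s _ => by
              rw [Pi.smul_apply, IsLNormedSpace.smul]
              exact rpow_mul_le hc (h0 _) hp0 hn
        _ = (modulus L k c + 1) ^ n * ∑ s ∈ F, rpow (lnorm L (f s)) p.toReal := by
            rw [← Finset.mul_sum]
        _ ≤ _ := mul_le_mul_of_nonneg_left (hM ⟨F, rfl⟩)
            (pow_nonneg (add_nonneg hc zero_le_one) n)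

open Classical in
/-- The norm of `ℓ^p(S, Y)`: `sup ‖f s‖` for `p = ∞`, and for `p < ∞` the `1/p`-th power of the sum
of the series `∑ ‖f s‖ ^ p`, which is the supremum of its finite partial sums. -/
instance (p : ℝ≥0∞) [Fact (1 ≤ p)] : LNorm L (lp L k S Y p) :=
  ⟨fun f => if p = ∞ then sSup (Set.range fun s => lnorm L (f.1 s))
    else rpow (sSup (Set.range fun F : Finset S => ∑ s ∈ F, rpow (lnorm L (f.1 s)) p.toReal))
      (1 / p.toReal)⟩

/-- `c₀(S, Y)`: the functions in `ℓ^∞(S, Y)` for which there is `E ⊆ L⁺` with `inf E = 0` such that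
for every `ε ∈ E` there is a cofinite `C ⊆ S` with `‖f s‖ ≤ ε` for all `s ∈ C`. -/
def c0 : Submodule (Scalar L k) (S → Y) where
  carrier := {f | Memlp L ∞ f ∧
    ∃ E : Set L, IsGLB E 0 ∧ ∀ ε ∈ E, ∃ C : Set S, Cᶜ.Finite ∧ ∀ s ∈ C, lnorm L (f s) ≤ ε}
  zero_mem' := by
    have h0 : lnorm L (0 : Y) = 0 := by
      have := IsLNormedSpace.smul (L := L) (0 : Scalar L k) (0 : Y)
      rwa [zero_smul, modulus_zero, zero_mul] at this
    refine ⟨(lp L k S Y ∞).zero_mem, {0}, isGLB_singleton, ?_⟩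
    rintro _ rfl
    exact ⟨Set.univ, by simp, fun s _ => h0.le⟩
  add_mem' := by
    rintro f g ⟨hf, E, hE, h⟩ ⟨hg, E', hE', h'⟩
    refine ⟨(lp L k S Y ∞).add_mem hf hg, E + E', ?_, ?_⟩
    · simpa using hE.add hE'
    · rintro _ ⟨ε, hε, ε', hε', rfl⟩
      obtain ⟨C, hC, hCf⟩ := h ε hε
      obtain ⟨C', hC', hCg⟩ := h' ε' hε'
      refine ⟨C ∩ C', by rw [Set.compl_inter]; exact hC.union hC', fun s hs => ?_⟩
      exact (IsLNormedSpace.add_le k _ _).trans (add_le_add (hCf s hs.1) (hCg s hs.2))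
  smul_mem' := by
    rintro c f ⟨hf, E, hE, h⟩
    have hc := modulus_nonneg k c
    refine ⟨(lp L k S Y ∞).smul_mem c hf, (fun x => modulus L k c * x) '' E, ?_, ?_⟩
    · rcases E.eq_empty_or_nonempty with rfl | hne
      · have h1 : ∀ x : L, x ≤ 0 := fun x => hE.2 (by simp)
        simpa [IsTop] using h1
      · simpa using isGLB_mul hc hne hE
    · rintro _ ⟨ε, hε, rfl⟩
      obtain ⟨C, hC, hCf⟩ := h ε hε
      exact ⟨C, hC, fun s hs => (IsLNormedSpace.smul c (f s)).le.trans
        (mul_le_mul_of_nonneg_left (hCf s hs) hc)⟩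

/-- The supremum norm of `c₀(S, Y)`. -/
instance : LNorm L (c0 L k S Y) := ⟨fun f => sSup (Set.range fun s => lnorm L (f.1 s))⟩

end Sequence

/-- An isometric isomorphism: a surjective linear map that preserves the norm. -/
structure LIsometryEquiv (X Z : Type*) [AddCommGroup X] [Module (Scalar L k) X] [LNorm L X]
    [AddCommGroup Z] [Module (Scalar L k) Z] [LNorm L Z] extends X ≃ₗ[Scalar L k] Z where
  lnorm_map : ∀ x, lnorm L (toFun x) = lnorm L x

end Norms

end LAnalysis

end

/-!
The classical proof of the duality of sequence spaces carries over once two obstacles are removed: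
an element of `L` need not be invertible, and its powers are only given as a supremum.

*Powers.* If `π ≠ 0` is an idempotent, then `π` has a nonzero sub-idempotent on which finitely many
given positive elements of `L` are equal to real numbers, up to a factor `θ > 1` as close to `1` as
desired (`exists_near_finset`). Sums, products and powers respect such approximations, and an
inequality in `L` follows if it holds up to a factor `θ ^ C` on a dense set of idempotents
(`le_of_near`). In this way the rules for real powers, and Hölder's inequality for finite sums
(`sum_mul_le_rpow_mul_rpow`), pass from the real numbers to `L`. The same method gives
`T ≤ m ^ q` whenever `T ≤ m * T ^ (1 / p)` (`le_rpow_of_le_mul_rpow`), where one would divide by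
`T ^ (1 / p)` in the classical proof.

*Norms of functionals.* The norm of a functional is the supremum of its positive values on the unit
ball (`isLUB_lnorm_dual`); vectors and scalars are normalized by dividing by `‖x‖ + ε`, which is
invertible. As multiplication and addition in `L` respect suprema, a weighted sum of norms of
functionals `φ ∘ ι s`, where `ι s y` is the function with value `y` at `s` and zero elsewhere, is
bounded by testing `φ` on functions of finite support (`sum_mul_lnorm_le`).

*Duality.* `exists_duality` extracts what is needed from a space `X` of functions with values in `Y`
and a space `W` of functions with values in `Y*`: Hölder's inequality, which makes the pairing
converge absolutely and hence converge by Dedekind completeness (`exists_hasLSum`); the density of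
the functions of finite support in `X`; and the converse of Hölder's inequality. For `ℓ^p` with
`1 < p < ∞` the converse follows from `sum_mul_lnorm_le` with the weights `‖g s‖ ^ (q - 1)`; for
`ℓ¹` it is immediate, and for `c₀` the weights are constant. The values of `W` are taken in any space
`V` with an isometric isomorphism onto `Y*`, so that `Y = V = L` is covered by `scalarDual`.
-/

noncomputable section

set_option linter.unusedSectionVars false

namespace LAnalysis

/-! ### Localization at idempotents -/

section FAlgebra

variable {L : Type*} [CommRing L] [ConditionallyCompleteLattice L] [IsOrderedRing L] [IsFAlgebra L]
  [Algebra ℝ L] [IsOrderedModule ℝ L]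

theorem le_of_smul_idem_le {π : L} (hπ : π * π = π) (h0 : π ≠ 0) {a b : ℝ} (h : a • π ≤ b • π) :
    a ≤ b := by
  by_contra! hab
  apply h0
  refine le_antisymm ?_ (idem_nonneg hπ)
  have h1 : (a - b) • π ≤ 0 := by rw [sub_smul]; exact sub_nonpos.2 h
  have h2 := smul_le_smul_of_nonneg_left h1 (inv_pos.2 (sub_pos.2 hab)).le
  rwa [inv_smul_smul₀ (sub_pos.2 hab).ne', smul_zero] at h2

/-- An inequality may be checked on a dense set of idempotents: if `z ≤ ε` fails, then
`ε ≤ z` on some nonzero idempotent. -/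
theorem nonpos_of_dense {z : L}
    (h : ∀ ρ : L, ρ * ρ = ρ → ρ ≠ 0 → ∃ π : L, π * π = π ∧ π ≠ 0 ∧ π * ρ = π ∧ π * z ≤ 0) :
    z ≤ 0 := by
  apply arch_real (y := 1)
  intro ε hε
  obtain ⟨e, he, h1, h2⟩ := comparison (z - ε • (1 : L))
  by_cases h0 : e = 0
  · subst h0
    rw [sub_zero, one_mul] at h2
    exact sub_nonpos.1 h2
  obtain ⟨π, hπ, hπ0, hπe, hz⟩ := h e he h0
  have h3 := mul_nonneg (idem_nonneg hπ) h1
  rw [← mul_assoc, hπe, mul_sub, ← smul_eq_mul_one] at h3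
  have h4 : ε • π ≤ (0 : ℝ) • π := by rw [zero_smul]; exact (sub_nonneg.1 h3).trans hz
  exact absurd (le_of_smul_idem_le hπ hπ0 h4) hε.not_ge

theorem idem_split_le (x : L) (r : ℝ) {ρ : L} (hρ : ρ * ρ = ρ) :
    (∃ π : L, π * π = π ∧ π ≠ 0 ∧ π * ρ = π ∧ π * x ≤ r • π) ∨ r • ρ ≤ ρ * x := by
  obtain ⟨e, he, h1, h2⟩ := comparison (r • (1 : L) - x)
  rw [mul_sub, ← smul_eq_mul_one] at h1 h2
  by_cases h0 : e * ρ = 0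
  · right
    have h3 := mul_nonpos_of_nonneg_of_nonpos (idem_nonneg hρ) h2
    rw [mul_sub, mul_smul_comm, ← mul_assoc, mul_sub, mul_one, mul_comm ρ e, h0, sub_zero] at h3
    exact sub_nonpos.1 h3
  · left
    refine ⟨e * ρ, idem_mul he hρ, h0, by rw [mul_assoc, hρ], ?_⟩
    have h3 := mul_nonneg (idem_nonneg hρ) h1
    rw [mul_sub, mul_smul_comm, ← mul_assoc, mul_comm ρ e] at h3
    exact sub_nonneg.1 h3

theorem idem_split_ge (x : L) (r : ℝ) {ρ : L} (hρ : ρ * ρ = ρ) :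
    (∃ π : L, π * π = π ∧ π ≠ 0 ∧ π * ρ = π ∧ r • π ≤ π * x) ∨ ρ * x ≤ r • ρ := by
  have h := idem_split_le (-x) (-r) hρ
  simpa only [mul_neg, neg_smul, neg_le_neg_iff] using h

/-- On the idempotent `π` the element `x` equals the real number `t ≥ 0` up to the factor `θ`, which
is placed on the upper bound only. The error is relative, so `t = 0` forces `x` to vanish on `π`. -/
def Near (π : L) (θ : ℝ) (x : L) (t : ℝ) : Prop :=
  0 ≤ t ∧ t • π ≤ π * x ∧ π * x ≤ (θ * t) • π

theorem Near.restrict {π π' x : L} {θ t : ℝ} (h : Near π θ x t) (h' : π' * π' = π')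
    (hle : π' * π = π') : Near π' θ x t := by
  have h0 := idem_nonneg h'
  refine ⟨h.1, ?_, ?_⟩
  · have := mul_le_mul_of_nonneg_left h.2.1 h0
    rwa [mul_smul_comm, ← mul_assoc, hle] at this
  · have := mul_le_mul_of_nonneg_left h.2.2 h0
    rwa [mul_smul_comm, ← mul_assoc, hle] at this

/-- Below every nonzero idempotent there is a nonzero one on which `x` vanishes or lies between
`t > 0` and `θ * t`. -/
theorem exists_near {x : L} (hx : 0 ≤ x) {θ : ℝ} (hθ : 1 < θ) {ρ : L} (hρ : ρ * ρ = ρ)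
    (hρ0 : ρ ≠ 0) : ∃ (π : L) (t : ℝ), π * π = π ∧ π ≠ 0 ∧ π * ρ = π ∧ Near π θ x t := by
  -- `x` is bounded on some `π₁ ≤ ρ`,
  obtain ⟨N, π₁, h₁, h₁0, h₁ρ, hN⟩ : ∃ (N : ℕ) (π : L), π * π = π ∧ π ≠ 0 ∧ π * ρ = π ∧
      π * x ≤ (N : ℝ) • π := by
    by_contra! hcon
    apply hρ0
    refine le_antisymm (arch (y := ρ * x) fun N => ?_) (idem_nonneg hρ)
    rcases idem_split_le x N hρ with ⟨π, a, b, c, d⟩ | h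
    · exact absurd d (hcon N π a b c)
    · rwa [Nat.cast_smul_eq_nsmul] at h
  by_cases hz : π₁ * x = 0
  · exact ⟨π₁, 0, h₁, h₁0, h₁ρ, le_rfl, by simp [hz], by simp [hz]⟩
  -- and, unless it vanishes there, bounded away from zero on some `π₂ ≤ π₁`.
  obtain ⟨r, hr, π₂, h₂, h₂0, h₂₁, hr₂⟩ : ∃ r : ℝ, 0 < r ∧ ∃ π : L, π * π = π ∧ π ≠ 0 ∧
      π * π₁ = π ∧ r • π ≤ π * x := by
    by_contra! hcon
    apply hz
    refine le_antisymm (arch_real (y := π₁) fun r hr => ?_) (mul_nonneg (idem_nonneg h₁) hx)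
    rcases idem_split_ge x r h₁ with ⟨π, a, b, c, d⟩ | h
    · exact absurd d (hcon r hr π a b c)
    · exact h
  have h₂ρ : π₂ * ρ = π₂ := by rw [← h₂₁, mul_assoc, h₁ρ]
  have hN₂ : π₂ * x ≤ (N : ℝ) • π₂ := by
    have := mul_le_mul_of_nonneg_left hN (idem_nonneg h₂)
    rwa [← mul_assoc, mul_smul_comm, h₂₁] at this
  obtain ⟨n, hn⟩ := pow_unbounded_of_one_lt ((N : ℝ) / r) hθ
  rw [div_lt_iff₀ hr] at hn
  have hup : π₂ * x ≤ (θ ^ n * r) • π₂ :=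
    hN₂.trans (smul_le_smul_of_nonneg_right hn.le (idem_nonneg h₂))
  clear hN₂ hN hn
  -- Cut the range `[r, θ ^ n * r]` at `θ * r`, until a piece `[r, θ * r]` is hit.
  have hθ0 : 0 < θ := one_pos.trans hθ
  induction n generalizing r with
  | zero =>
    refine ⟨π₂, r, h₂, h₂0, h₂ρ, hr.le, hr₂, hup.trans ?_⟩
    rw [pow_zero]
    exact smul_le_smul_of_nonneg_right (mul_le_mul_of_nonneg_right hθ.le hr.le) (idem_nonneg h₂)
  | succ n ih =>
    rcases idem_split_le x (θ * r) h₂ with ⟨π, a, b, c, d⟩ | h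
    · refine ⟨π, r, a, b, by rw [← c, mul_assoc, h₂ρ], hr.le, ?_, d⟩
      have := mul_le_mul_of_nonneg_left hr₂ (idem_nonneg a)
      rwa [mul_smul_comm, ← mul_assoc, c] at this
    · refine ih (θ * r) (mul_pos hθ0 hr) h ?_
      rwa [← mul_assoc, ← pow_succ]

theorem exists_near_finset {ι : Type*} (F : Finset ι) {x : ι → L} (hx : ∀ i, 0 ≤ x i) {θ : ℝ}
    (hθ : 1 < θ) {ρ : L} (hρ : ρ * ρ = ρ) (hρ0 : ρ ≠ 0) :
    ∃ (π : L) (t : ι → ℝ), π * π = π ∧ π ≠ 0 ∧ π * ρ = π ∧ ∀ i ∈ F, Near π θ (x i) (t i) := by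
  classical
  induction F using Finset.induction_on with
  | empty => exact ⟨ρ, 0, hρ, hρ0, hρ, by simp⟩
  | insert i F hi ih =>
    obtain ⟨π, t, h1, h2, h3, h4⟩ := ih
    obtain ⟨π', s, g1, g2, g3, g4⟩ := exists_near (hx i) hθ h1 h2
    refine ⟨π', Function.update t i s, g1, g2, by rw [← g3, mul_assoc, h3], fun j hj => ?_⟩
    rcases eq_or_ne j i with rfl | hji
    · simpa using g4
    · rw [Function.update_of_ne hji]
      exact (h4 j (Finset.mem_of_mem_insert_of_ne hj hji)).restrict g1 g3

/-- An inequality between expressions in finitely many positive elements `x i` may be checked on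
idempotents on which every `x i` is nearly a real number, up to a factor `θ ^ C` with a fixed
exponent `C`. -/
theorem le_of_near {ι : Type*} (F : Finset ι) {x : ι → L} (hx : ∀ i, 0 ≤ x i) {A B : L} {C : ℝ}
    (hC : 0 < C) (h : ∀ (θ : ℝ) (π : L) (t : ι → ℝ), 1 < θ → π * π = π → π ≠ 0 →
      (∀ i ∈ F, Near π θ (x i) (t i)) → π * A ≤ (θ ^ C) • (π * B)) : A ≤ B := by
  rw [← sub_nonpos]
  apply arch_real (y := B)
  intro ε hε
  -- The factor `θ` with `θ ^ C = 1 + ε`.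
  have h1 : 1 < (1 + ε) ^ C⁻¹ := Real.one_lt_rpow (by linarith) (inv_pos.2 hC)
  rw [← sub_nonpos]
  apply nonpos_of_dense
  intro ρ hρ hρ0
  obtain ⟨π, t, g1, g2, g3, g4⟩ := exists_near_finset F hx h1 hρ hρ0
  refine ⟨π, g1, g2, g3, ?_⟩
  have := h _ π t h1 g1 g2 g4
  rw [Real.rpow_inv_rpow (by linarith) hC.ne', add_smul, one_smul] at this
  rw [mul_sub, mul_sub, mul_smul_comm, sub_nonpos, sub_le_iff_le_add']
  exact this

/-- Near real values that are comparable up to a factor make the elements comparable. Only the lower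
bound on `B` is used, so its relative error `η` does not enter. -/
theorem Near.le {π A B : L} {θ η t s c : ℝ} (hπ : π * π = π) (hA : Near π θ A t)
    (hB : Near π η B s) (hc : 0 ≤ c) (h : θ * t ≤ c * s) : π * A ≤ c • (π * B) := by
  refine hA.2.2.trans ((smul_le_smul_of_nonneg_right h (idem_nonneg hπ)).trans ?_)
  rw [mul_smul]
  exact smul_le_smul_of_nonneg_left hB.2.1 hc

/-- Two elements are equal if they are nearly the same real number wherever `x` is nearly real. -/
theorem eq_of_near {x A B : L} (hx : 0 ≤ x) {C : ℝ} (hC : 0 < C)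
    (h : ∀ (θ : ℝ) (π : L) (t : ℝ), 1 < θ → π * π = π → π ≠ 0 → Near π θ x t →
      ∃ s, Near π (θ ^ C) A s ∧ Near π (θ ^ C) B s) : A = B := by
  apply le_antisymm <;>
  · refine le_of_near (x := fun _ : Unit => x) Finset.univ (fun _ => hx) hC ?_
    intro θ π t hθ hπ hπ0 ht
    obtain ⟨s, hA, hB⟩ := h θ π (t ()) hθ hπ hπ0 (ht () (Finset.mem_univ _))
    have h0 : 0 ≤ θ ^ C := Real.rpow_nonneg (by linarith) _
    first
      | exact hA.le hπ hB h0 le_rfl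
      | exact hB.le hπ hA h0 le_rfl

/-! ### The calculus of powers -/

theorem Near.mul {π x y : L} {θ η t s : ℝ} (hπ : π * π = π) (hθ : 0 ≤ θ)
    (hx : Near π θ x t) (hy : Near π η y s) : Near π (θ * η) (x * y) (t * s) := by
  have h0 := idem_nonneg hπ
  have e : π * (x * y) = π * x * (π * y) := by linear_combination (-(x * y)) * hπ
  refine ⟨mul_nonneg hx.1 hy.1, ?_, ?_⟩
  · have := mul_le_mul hx.2.1 hy.2.1 (smul_nonneg hy.1 h0)
      ((smul_nonneg hx.1 h0).trans hx.2.1)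
    rwa [smul_mul_smul_comm, hπ, ← e] at this
  · have := mul_le_mul hx.2.2 hy.2.2 ((smul_nonneg hy.1 h0).trans hy.2.1)
      (smul_nonneg (mul_nonneg hθ hx.1) h0)
    rwa [smul_mul_smul_comm, hπ, ← e, mul_mul_mul_comm] at this

theorem Near.sum {ι : Type*} {F : Finset ι} {π : L} {x : ι → L} {θ : ℝ} {t : ι → ℝ}
    (h : ∀ i ∈ F, Near π θ (x i) (t i)) : Near π θ (∑ i ∈ F, x i) (∑ i ∈ F, t i) := by
  refine ⟨Finset.sum_nonneg fun i hi => (h i hi).1, ?_, ?_⟩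
  · rw [Finset.sum_smul, Finset.mul_sum]
    exact Finset.sum_le_sum fun i hi => (h i hi).2.1
  · rw [Finset.mul_sum, Finset.mul_sum, Finset.sum_smul]
    exact Finset.sum_le_sum fun i hi => (h i hi).2.2

theorem Near.rpow {π x : L} {θ t p : ℝ} (hπ : π * π = π) (hx : 0 ≤ x) (hθ : 0 ≤ θ)
    (hp : 0 ≤ p) (h : Near π θ x t) : Near π (θ ^ p) (rpow x p) (t ^ p) := by
  have h0 := idem_nonneg hπ
  refine ⟨Real.rpow_nonneg h.1 _, ?_, ?_⟩
  · have := mul_le_mul_of_nonneg_left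
      (le_rpow hx hp h.1 hπ (h.2.1.trans (idem_mul_le hπ hx))) h0
    rwa [mul_smul_comm, hπ] at this
  · apply (isLUB_mul h0 (rpow_set_nonempty hx p) (rpow_isLUB hx hp)).2
    rintro _ ⟨_, ⟨a, e, ha, he, hae, rfl⟩, rfl⟩
    have hpe := idem_mul hπ he
    have hr : 0 ≤ θ ^ p * t ^ p := mul_nonneg (Real.rpow_nonneg hθ _) (Real.rpow_nonneg h.1 _)
    simp only
    rw [mul_smul_comm]
    -- Either `e` does not meet `π`, or `a • e ≤ x` forces `a ≤ θ * t`.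
    by_cases hz : π * e = 0
    · rw [hz, smul_zero]
      exact smul_nonneg hr h0
    have h1 : a • (π * e) ≤ (θ * t) • (π * e) := by
      have := mul_le_mul_of_nonneg_left (mul_le_mul_of_nonneg_left hae h0) (idem_nonneg he)
      have h2 := mul_le_mul_of_nonneg_left h.2.2 (idem_nonneg he)
      rw [mul_smul_comm, mul_smul_comm, show e * (π * e) = π * e by
        linear_combination π * he] at this
      rw [mul_smul_comm, mul_comm e π] at h2
      exact this.trans h2
    have h2 := Real.rpow_le_rpow ha (le_of_smul_idem_le hpe hz h1) hp
    rw [Real.mul_rpow hθ h.1] at h2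
    refine (smul_le_smul_of_nonneg_right h2 (idem_nonneg hpe)).trans
      (smul_le_smul_of_nonneg_left ?_ hr)
    rw [mul_comm]
    exact idem_mul_le he h0

theorem rpow_one {x : L} (hx : 0 ≤ x) : rpow x 1 = x := by
  refine eq_of_near hx one_pos fun θ π t hθ hπ _ ht => ⟨t, ?_, ?_⟩
  · simpa using ht.rpow hπ hx (by linarith) zero_le_one
  · simpa using ht

theorem rpow_rpow {x : L} (hx : 0 ≤ x) {p r : ℝ} (hp : 0 < p) (hr : 0 < r) :
    rpow (rpow x p) r = rpow x (p * r) := by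
  refine eq_of_near hx (mul_pos hp hr) fun θ π t hθ hπ _ ht => ⟨t ^ (p * r), ?_, ?_⟩
  · have := (ht.rpow hπ hx (by linarith) hp.le).rpow hπ (rpow_nonneg hx hp.le)
      (Real.rpow_nonneg (by linarith) _) hr.le
    rwa [← Real.rpow_mul (by linarith), ← Real.rpow_mul ht.1] at this
  · exact ht.rpow hπ hx (by linarith) (mul_pos hp hr).le

theorem rpow_mul_rpow {x : L} (hx : 0 ≤ x) {p r : ℝ} (hp : 0 < p) (hr : 0 < r) :
    rpow x p * rpow x r = rpow x (p + r) := by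
  refine eq_of_near hx (add_pos hp hr) fun θ π t hθ hπ _ ht => ⟨t ^ (p + r), ?_, ?_⟩
  · have := (ht.rpow hπ hx (by linarith) hp.le).mul hπ (Real.rpow_nonneg (by linarith) _)
      (ht.rpow hπ hx (by linarith) hr.le)
    rwa [← Real.rpow_add (by linarith), ← Real.rpow_add_of_nonneg ht.1 hp.le hr.le] at this
  · exact ht.rpow hπ hx (by linarith) (add_pos hp hr).le

theorem rpow_rpow_one_div {x : L} (hx : 0 ≤ x) {p : ℝ} (hp : 0 < p) :
    rpow (rpow x p) (1 / p) = x := by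
  rw [rpow_rpow hx hp (by positivity), mul_one_div_cancel hp.ne', rpow_one hx]

theorem rpow_one_div_rpow {x : L} (hx : 0 ≤ x) {p : ℝ} (hp : 0 < p) :
    rpow (rpow x (1 / p)) p = x := by
  rw [rpow_rpow hx (by positivity) hp, one_div_mul_cancel hp.ne', rpow_one hx]

/-- Hölder's inequality for finite sums. -/
theorem sum_mul_le_rpow_mul_rpow {ι : Type*} (F : Finset ι) {x y : ι → L} (hx : ∀ i, 0 ≤ x i)
    (hy : ∀ i, 0 ≤ y i) {p q : ℝ} (hpq : p.HolderConjugate q) :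
    ∑ i ∈ F, x i * y i ≤
      rpow (∑ i ∈ F, rpow (x i) p) (1 / p) * rpow (∑ i ∈ F, rpow (y i) q) (1 / q) := by
  have hp := hpq.pos
  have hq := hpq.symm.pos
  -- The exponent is two because the left side is near its real value up to `θ * θ`.
  refine le_of_near (F.disjSum F) (x := Sum.elim x y) (by rintro (i | i) <;> simp [hx, hy])
    two_pos fun θ π t hθ hπ hπ0 ht => ?_
  have hθ0 : 0 ≤ θ := by linarith
  have ht1 : ∀ i ∈ F, Near π θ (x i) (t (.inl i)) := fun i hi =>
    ht (.inl i) (Finset.inl_mem_disjSum.2 hi)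
  have ht2 : ∀ i ∈ F, Near π θ (y i) (t (.inr i)) := fun i hi =>
    ht (.inr i) (Finset.inr_mem_disjSum.2 hi)
  have hA := Near.sum fun i hi => (ht1 i hi).mul hπ hθ0 (ht2 i hi)
  have hX := (Near.sum fun i hi => (ht1 i hi).rpow hπ (hx i) hθ0 hp.le).rpow hπ
    (Finset.sum_nonneg fun i _ => rpow_nonneg (hx i) hp.le)
    (Real.rpow_nonneg hθ0 _) (one_div_nonneg.2 hp.le)
  have hY := (Near.sum fun i hi => (ht2 i hi).rpow hπ (hy i) hθ0 hq.le).rpow hπ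
    (Finset.sum_nonneg fun i _ => rpow_nonneg (hy i) hq.le)
    (Real.rpow_nonneg hθ0 _) (one_div_nonneg.2 hq.le)
  refine hA.le hπ (hX.mul hπ (Real.rpow_nonneg (Real.rpow_nonneg hθ0 _) _) hY)
    (Real.rpow_nonneg hθ0 _) ?_
  rw [Real.rpow_two, sq]
  refine mul_le_mul_of_nonneg_left ?_ (mul_nonneg hθ0 hθ0)
  exact Real.inner_le_Lp_mul_Lq_of_nonneg F hpq (fun i hi => (ht1 i hi).1)
    fun i hi => (ht2 i hi).1

/-- Cancellation of `T ^ (1 / p)`, although it need not be invertible. -/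
theorem le_rpow_of_le_mul_rpow {T m : L} (hT : 0 ≤ T) (hm : 0 ≤ m) {p q : ℝ}
    (hpq : p.HolderConjugate q) (h : T ≤ m * rpow T (1 / p)) : T ≤ rpow m q := by
  have hp := hpq.pos
  have hq := hpq.symm.pos
  have hp' : 0 < 1 / p := one_div_pos.2 hp
  refine le_of_near (Finset.univ : Finset Bool) (x := fun b => cond b T m)
    (by rintro (_ | _) <;> assumption) (C := 1 + (1 + 1 / p) * q) (by positivity)
    fun θ π t hθ hπ hπ0 ht => ?_
  have hθ0 : 0 < θ := by linarith
  have hT' : Near π θ T (t true) := ht true (Finset.mem_univ _)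
  have hm' : Near π θ m (t false) := ht false (Finset.mem_univ _)
  refine hT'.le hπ (hm'.rpow hπ hm hθ0.le hq.le) (Real.rpow_nonneg hθ0.le _) ?_
  have h1 := (hm'.mul hπ hθ0.le (hT'.rpow hπ hT hθ0.le hp'.le)).2.2
  have h2 := le_of_smul_idem_le hπ hπ0
    ((hT'.2.1.trans (mul_le_mul_of_nonneg_left h (idem_nonneg hπ))).trans h1)
  generalize t true = a at *
  generalize t false = b at *
  have ha := hT'.1
  have hb := hm'.1
  rw [Real.rpow_add hθ0, Real.rpow_one, mul_assoc]
  refine mul_le_mul_of_nonneg_left ?_ hθ0.le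
  rcases ha.eq_or_lt with rfl | ha
  · positivity
  have h3 : a ^ (1 / q) ≤ θ ^ (1 + 1 / p) * b := by
    have e : a = a ^ (1 / p) * a ^ (1 / q) := by
      rw [← Real.rpow_add ha, one_div, one_div, hpq.inv_add_inv_eq_one, Real.rpow_one]
    rw [Real.rpow_add hθ0, Real.rpow_one]
    refine le_of_mul_le_mul_left ?_ (Real.rpow_pos_of_pos ha (1 / p))
    rw [← e]
    exact h2.trans (le_of_eq (by ring))
  have h4 := Real.rpow_le_rpow (Real.rpow_nonneg ha.le _) h3 hq.le
  rwa [one_div, Real.rpow_inv_rpow ha.le hq.ne', Real.mul_rpow (by positivity) hb,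
    ← Real.rpow_mul hθ0.le] at h4

end FAlgebra

/-! ### Scalars -/

section Norms

variable {L : Type*} [CommRing L] [ConditionallyCompleteLattice L] [IsOrderedRing L]
  [IsFAlgebra L] [Algebra ℝ L] [IsOrderedModule ℝ L] (k : ScalarKind)

/-- The embedding of `L` into the scalars. -/
def ofL : (k : ScalarKind) → L →+* Scalar L k
  | .real => RingHom.id L
  | .complex => algebraMap L (QuadraticAlgebra L (-1) 0)

theorem modulus_ofL (x : L) : modulus L k (ofL k x) = |x| := by
  cases k with
  | real => rfl
  | complex =>
    change rpow (x * x + 0 * 0) (1 / 2) = |x|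
    apply eq_of_sq_eq (root_nonneg _ _) (abs_nonneg _)
    rw [root_sq, abs_mul_self', mul_zero, add_zero]

theorem modulus_ofL_of_nonneg {x : L} (hx : 0 ≤ x) : modulus L k (ofL k x) = x := by
  rw [modulus_ofL, abs_of_nonneg hx]

/-- The conjugate `w` of a scalar `z`, with `w * z = |z| ^ 2`. -/
theorem exists_conj (z : Scalar L k) : ∃ w : Scalar L k, modulus L k w = modulus L k z ∧
    w * z = ofL k (modulus L k z * modulus L k z) := by
  cases k with
  | real => exact ⟨z, rfl, (abs_mul_self' (L := L) z).symm⟩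
  | complex =>
    have key : ∀ z : QuadraticAlgebra L (-1) 0, ∃ w : QuadraticAlgebra L (-1) 0,
        rpow (w.re * w.re + w.im * w.im) (1 / 2) = rpow (z.re * z.re + z.im * z.im) (1 / 2) ∧
        w * z = algebraMap L (QuadraticAlgebra L (-1) 0)
          (rpow (z.re * z.re + z.im * z.im) (1 / 2) *
            rpow (z.re * z.re + z.im * z.im) (1 / 2)) := by
      intro z
      refine ⟨⟨z.re, -z.im⟩, by simp, ?_⟩
      rw [root_sq]
      ext
      · simp
      · simp; ring
    exact key z

/-- Every scalar is a fixed combination of four positive elements that are dominated by its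
modulus: the positive and negative parts of its real and imaginary part. -/
theorem exists_pos_decomposition : ∃ (ω : Fin 4 → Scalar L k) (v : Fin 4 → Scalar L k → L),
    (∀ j z, 0 ≤ v j z ∧ v j z ≤ modulus L k z) ∧ ∀ z, z = ∑ j, ω j * ofL k (v j z) := by
  have posneg : ∀ x y : L, |x| ≤ y → (0 ≤ x⁺ ∧ x⁺ ≤ y) ∧ (0 ≤ x⁻ ∧ x⁻ ≤ y) := fun x y h => by
    have hp := posPart_nonneg x
    have hn := negPart_nonneg x
    rw [← posPart_add_negPart x] at h
    exact ⟨⟨hp, (le_add_of_nonneg_right hn).trans h⟩, hn, (le_add_of_nonneg_left hp).trans h⟩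
  cases k with
  | real =>
    refine ⟨![1, -1, 0, 0], ![fun z : L => z⁺, fun z : L => z⁻, fun _ => 0, fun _ => 0], ?_, ?_⟩
    · intro j z
      have := posneg z |(z : L)| le_rfl
      fin_cases j
      · exact this.1
      · exact this.2
      · exact ⟨le_rfl, abs_nonneg (α := L) z⟩
      · exact ⟨le_rfl, abs_nonneg (α := L) z⟩
    · intro z
      rw [Fin.sum_univ_four]
      have key : ∀ z : L, z = 1 * z⁺ + -1 * z⁻ + 0 * 0 + 0 * 0 := fun z => by
        linear_combination -posPart_sub_negPart z
      exact key z
  | complex =>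
    let v : Fin 4 → QuadraticAlgebra L (-1) 0 → L :=
      ![fun z => z.re⁺, fun z => z.re⁻, fun z => z.im⁺, fun z => z.im⁻]
    let ω : Fin 4 → QuadraticAlgebra L (-1) 0 := ![1, -1, ⟨0, 1⟩, -⟨0, 1⟩]
    have h1 : ∀ j (z : QuadraticAlgebra L (-1) 0), 0 ≤ v j z ∧
        v j z ≤ rpow (z.re * z.re + z.im * z.im) (1 / 2) := by
      intro j z
      have hr : |z.re| ≤ rpow (z.re * z.re + z.im * z.im) (1 / 2) := by
        apply sq_le_sq_imp (root_nonneg _ _)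
        rw [root_sq, abs_mul_self']
        exact le_add_of_nonneg_right (self_mul_nonneg _)
      have hi : |z.im| ≤ rpow (z.re * z.re + z.im * z.im) (1 / 2) := by
        apply sq_le_sq_imp (root_nonneg _ _)
        rw [root_sq, abs_mul_self']
        exact le_add_of_nonneg_left (self_mul_nonneg _)
      fin_cases j
      · exact (posneg _ _ hr).1
      · exact (posneg _ _ hr).2
      · exact (posneg _ _ hi).1
      · exact (posneg _ _ hi).2
    have h2 : ∀ z : QuadraticAlgebra L (-1) 0,
        z = ∑ j, ω j * algebraMap L (QuadraticAlgebra L (-1) 0) (v j z) := by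
      intro z
      rw [Fin.sum_univ_four]
      change z = 1 * algebraMap L (QuadraticAlgebra L (-1) 0) z.re⁺ +
        -1 * algebraMap L (QuadraticAlgebra L (-1) 0) z.re⁻ +
        (⟨0, 1⟩ : QuadraticAlgebra L (-1) 0) * algebraMap L (QuadraticAlgebra L (-1) 0) z.im⁺ +
        -(⟨0, 1⟩ : QuadraticAlgebra L (-1) 0) * algebraMap L (QuadraticAlgebra L (-1) 0) z.im⁻
      have hr := posPart_sub_negPart z.re
      have hi := posPart_sub_negPart z.im
      ext
      · simp
        linear_combination -hr
      · simp
        linear_combination -hi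
    exact ⟨ω, v, h1, h2⟩

/-! ### Series -/

theorem isGLB_mul_zero {c : L} (hc : 0 ≤ c) {E : Set L} (hE : IsGLB E 0) :
    IsGLB ((fun x => c * x) '' E) 0 := by
  rcases E.eq_empty_or_nonempty with rfl | hne
  · have h1 : ∀ x : L, x ≤ 0 := fun x => hE.2 (by simp)
    simpa [IsTop] using h1
  · simpa using isGLB_mul hc hne hE

theorem isGLB_add_zero {E E' : Set L} (hE : IsGLB E 0) (hE' : IsGLB E' 0) :
    IsGLB (Set.image2 (· + ·) E E') 0 := by
  have := hE.add hE'
  rwa [add_zero] at this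

section Space

variable {X : Type*} [AddCommGroup X] [LNorm L X]

theorem lnorm_zero (k : ScalarKind) [Module (Scalar L k) X] [IsLNormedSpace L k X]
    : lnorm L (0 : X) = 0 := by
  have := IsLNormedSpace.smul (L := L) (0 : Scalar L k) (0 : X)
  rwa [zero_smul, modulus_zero, zero_mul] at this

theorem lnorm_neg (k : ScalarKind) [Module (Scalar L k) X] [IsLNormedSpace L k X]
    (x : X) : lnorm L (-x) = lnorm L x := by
  have h := IsLNormedSpace.smul (L := L) (-1 : Scalar L k) x
  have h1 : modulus L k (-1) = 1 := by
    have := modulus_ofL (L := L) k (-1)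
    rwa [map_neg, map_one, abs_neg, abs_of_nonneg (zero_le_one (α := L))] at this
  rwa [neg_smul, one_smul, h1, one_mul] at h

theorem lnorm_sum_le (k : ScalarKind) [Module (Scalar L k) X] [IsLNormedSpace L k X]
    {I : Type*} (F : Finset I) (u : I → X) :
    lnorm L (∑ i ∈ F, u i) ≤ ∑ i ∈ F, lnorm L (u i) := by
  classical
  induction F using Finset.induction_on with
  | empty => simp [lnorm_zero (L := L) k]
  | insert i F hi ih =>
    rw [Finset.sum_insert hi, Finset.sum_insert hi]
    exact (IsLNormedSpace.add_le k _ _).trans (add_le_add_right ih _)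

variable {I : Type*} {u v : I → X} {x y : X}

theorem HasLSum.add (k : ScalarKind) [Module (Scalar L k) X] [IsLNormedSpace L k X]
    (hu : HasLSum L u x) (hv : HasLSum L v y) :
    HasLSum L (fun i => u i + v i) (x + y) := by
  classical
  obtain ⟨E, hE, h⟩ := hu
  obtain ⟨E', hE', h'⟩ := hv
  refine ⟨_, isGLB_add_zero hE hE', ?_⟩
  rintro _ ⟨ε, hε, ε', hε', rfl⟩
  obtain ⟨F, hF⟩ := h ε hε
  obtain ⟨F', hF'⟩ := h' ε' hε'
  refine ⟨F ∪ F', fun G hG => ?_⟩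
  simp only
  rw [Finset.sum_add_distrib, add_sub_add_comm]
  exact (IsLNormedSpace.add_le k _ _).trans (add_le_add
    (hF G (Finset.subset_union_left.trans hG)) (hF' G (Finset.subset_union_right.trans hG)))

theorem HasLSum.smul {k : ScalarKind} [Module (Scalar L k) X] [IsLNormedSpace L k X]
    (c : Scalar L k) (hu : HasLSum L u x) :
    HasLSum L (fun i => c • u i) (c • x) := by
  obtain ⟨E, hE, h⟩ := hu
  have hc := modulus_nonneg k c
  refine ⟨_, isGLB_mul_zero hc hE, ?_⟩
  rintro _ ⟨ε, hε, rfl⟩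
  obtain ⟨F, hF⟩ := h ε hε
  refine ⟨F, fun G hG => ?_⟩
  simp only
  rw [← Finset.smul_sum, ← smul_sub, IsLNormedSpace.smul]
  exact mul_le_mul_of_nonneg_left (hF G hG) hc

theorem HasLSum.unique (k : ScalarKind) [Module (Scalar L k) X] [IsLNormedSpace L k X]
    (hx : HasLSum L u x) (hy : HasLSum L u y) : x = y := by
  classical
  have h := hx.add k (hy.smul (-1 : Scalar L k))
  simp only [neg_smul, one_smul, add_neg_cancel, ← sub_eq_add_neg] at h
  obtain ⟨E, hE, h⟩ := h
  rw [← sub_eq_zero]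
  refine IsLNormedSpace.eq_zero (L := L) k _
    (le_antisymm (hE.2 fun ε hε => ?_) (IsLNormedSpace.nonneg k _))
  obtain ⟨F, hF⟩ := h ε hε
  have := hF F le_rfl
  simp only [Finset.sum_const_zero, zero_sub] at this
  rwa [lnorm_neg k] at this

theorem HasLSum.lnorm_le (k : ScalarKind) [Module (Scalar L k) X] [IsLNormedSpace L k X]
    {K : L} (hx : HasLSum L u x)
    (h : ∀ F : Finset I, ∑ i ∈ F, lnorm L (u i) ≤ K) : lnorm L x ≤ K := by
  obtain ⟨E, hE, hF⟩ := hx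
  rw [← sub_nonpos]
  refine hE.2 fun ε hε => ?_
  obtain ⟨F, hF⟩ := hF ε hε
  have h1 := hF F le_rfl
  rw [← lnorm_neg k, neg_sub] at h1
  rw [sub_le_iff_le_add]
  have h2 := IsLNormedSpace.add_le (L := L) k (x - ∑ i ∈ F, u i) (∑ i ∈ F, u i)
  rw [sub_add_cancel] at h2
  exact h2.trans (add_le_add h1 ((lnorm_sum_le k F u).trans (h F)))

theorem hasLSum_single (k : ScalarKind) [Module (Scalar L k) X] [IsLNormedSpace L k X]
    (i : I) (h : ∀ j, j ≠ i → u j = 0) : HasLSum L u (u i) := by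
  refine ⟨{0}, isGLB_singleton, ?_⟩
  rintro _ rfl
  refine ⟨{i}, fun F hF => ?_⟩
  simp only
  rw [Finset.sum_eq_single i (fun j _ => h j)
    (fun hi => absurd (hF (Finset.mem_singleton_self i)) hi), sub_self, lnorm_zero k]

end Space

variable {k}

theorem HasLSum.ofL {I : Type*} {v : I → L} {σ : L} (hv : HasLSum L v σ) :
    HasLSum L (fun i => ofL k (v i)) (ofL k σ) := by
  obtain ⟨E, hE, h⟩ := hv
  refine ⟨E, hE, fun ε hε => ?_⟩
  obtain ⟨F, hF⟩ := h ε hε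
  refine ⟨F, fun G hG => ?_⟩
  simp only
  rw [← map_sum, ← map_sub]
  exact (modulus_ofL k _).le.trans (hF G hG)

/-- An absolutely convergent series of scalars converges, by Dedekind completeness. -/
theorem exists_hasLSum {I : Type*} {u : I → Scalar L k} {K : L}
    (h : ∀ F : Finset I, ∑ i ∈ F, modulus L k (u i) ≤ K) : ∃ σ, HasLSum L u σ := by
  obtain ⟨ω, v, hv, hz⟩ := exists_pos_decomposition (L := L) k
  have h1 : ∀ j, ∃ σ : L, HasLSum L (fun i => v j (u i)) σ := fun j => by
    rw [summable_iff_bddAbove fun i => (hv j (u i)).1]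
    refine ⟨K, ?_⟩
    rintro _ ⟨F, rfl⟩
    exact (Finset.sum_le_sum fun i _ => (hv j (u i)).2).trans (h F)
  choose σ hσ using h1
  have h2 := fun j => ((hσ j).ofL (k := k)).smul (ω j)
  have h3 := (((h2 0).add k (h2 1)).add k (h2 2)).add k (h2 3)
  have e : u = fun i => ∑ j, ω j * LAnalysis.ofL k (v j (u i)) := funext fun i => hz (u i)
  simp only [Fin.sum_univ_four] at e
  rw [e]
  exact ⟨_, h3⟩

/-! ### The norm of the dual space -/

section Dual

variable {X : Type*} [AddCommGroup X] [Module (Scalar L k) X] [LNorm L X]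

/-- The norm of a functional is one of its bounds. This needs only that the norm of `X` is positive,
so that for `ℓ^p` and `c₀` the triangle inequality is not required. -/
theorem isBound_lnorm_of_nonneg (hX : ∀ x : X, 0 ≤ lnorm L x) (φ : Dual L k X) :
    IsBound L k φ.1 (lnorm L φ) := by
  have h := lnorm_dual_isGLB k φ
  refine ⟨h.2 fun M hM => hM.1, fun x => ?_⟩
  rw [mul_comm]
  apply (isGLB_mul (hX x) φ.2 h).2
  rintro _ ⟨M, hM, rfl⟩
  simp only
  rw [mul_comm]
  exact hM.2 x

theorem exists_inv_add_smul_one {x : L} (hx : 0 ≤ x) {ε : ℝ} (hε : 0 < ε) :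
    ∃ b : L, 0 ≤ b ∧ (x + ε • 1) * b = 1 := by
  obtain ⟨b, hb, h⟩ := exists_inv (L := L) (a := ε⁻¹ • x + 1)
    (le_add_of_nonneg_left (smul_nonneg (inv_pos.2 hε).le hx))
  refine ⟨ε⁻¹ • b, smul_nonneg (inv_pos.2 hε).le hb, ?_⟩
  have e : x + ε • 1 = ε • (ε⁻¹ • x + 1) := by rw [smul_add, smul_inv_smul₀ hε.ne']
  rw [e, smul_mul_smul_comm, mul_inv_cancel₀ hε.ne', one_smul, h]

variable [IsLNormedSpace L k X]

/-- The norm of a functional is the supremum of the values in `L` that it takes on the unit ball.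
A vector `x` is brought into the unit ball by dividing it by `‖x‖ + ε`, and the value at `x` is made
positive by multiplication with its conjugate, divided by its modulus plus `ε`. -/
theorem isLUB_lnorm_dual (h : Dual L k X) :
    IsLUB {r : L | ∃ x : X, lnorm L x ≤ 1 ∧ h x = ofL k r} (lnorm L h) := by
  have hb := isBound_lnorm k h
  constructor
  · rintro r ⟨x, hx, hr⟩
    calc r ≤ |r| := le_abs_self r
      _ = modulus L k (h x) := by rw [hr, modulus_ofL]
      _ ≤ lnorm L h * lnorm L x := hb.2 x
      _ ≤ lnorm L h * 1 := mul_le_mul_of_nonneg_left hx hb.1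
      _ = _ := mul_one _
  · intro m hm
    have hm0 : 0 ≤ m := hm ⟨0, by rw [lnorm_zero k]; exact zero_le_one, by
      rw [map_zero (ofL k)]; exact h.1.map_zero⟩
    refine (lnorm_dual_isGLB k h).1 ⟨hm0, fun x => ?_⟩
    rw [← sub_nonpos]
    apply arch_real (y := 1 + m)
    intro ε hε
    have hx0 : 0 ≤ lnorm L x := IsLNormedSpace.nonneg k x
    have hz0 := modulus_nonneg k (h.1 x)
    -- For `b = (‖x‖ + ε)⁻¹` and `d = (|h x| + ε)⁻¹` the vector `(d * b * w) • x` is in the unit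
    -- ball.
    obtain ⟨w, hw, hwz⟩ := exists_conj k (h.1 x)
    set z := modulus L k (h.1 x) with hz
    obtain ⟨b, hb0, hb⟩ := exists_inv_add_smul_one hx0 hε
    obtain ⟨d, hd0, hd⟩ := exists_inv_add_smul_one hz0 hε
    have hε1 : (0 : L) ≤ ε • 1 := smul_nonneg hε.le zero_le_one
    have hbx : b * lnorm L x ≤ 1 := by
      rw [← hb, mul_comm]
      exact mul_le_mul_of_nonneg_right (le_add_of_nonneg_right hε1) hb0
    have hdz : d * z ≤ 1 := by
      rw [← hd, mul_comm]
      exact mul_le_mul_of_nonneg_right (le_add_of_nonneg_right hε1) hd0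
    have h1 : d * (z * z) * b ≤ m := by
      refine hm ⟨(ofL k (d * b) * w) • x, ?_, ?_⟩
      · rw [IsLNormedSpace.smul, modulus_mul, modulus_ofL_of_nonneg k (mul_nonneg hd0 hb0), hw]
        calc d * b * z * lnorm L x = (d * z) * (b * lnorm L x) := by ring
          _ ≤ 1 * 1 := mul_le_mul hdz hbx (mul_nonneg hb0 hx0) zero_le_one
          _ = 1 := one_mul 1
      · change h.1 _ = _
        rw [map_smul, smul_eq_mul, mul_assoc, hwz, ← map_mul]
        congr 1
        ring
    -- The difference of the two sides is `d * ε ^ 2`, as `d = (z + ε)⁻¹`.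
    have h2 : z - ε • 1 ≤ d * (z * z) :=
      le_of_sub_eq (mul_nonneg hd0 (mul_nonneg hε1 hε1))
        (by linear_combination (z - ε • (1 : L)) * hd)
    have h3 : (z - ε • 1) * b ≤ m := (mul_le_mul_of_nonneg_right h2 hb0).trans h1
    have h4 := mul_le_mul_of_nonneg_right h3 (add_nonneg hx0 hε1)
    have h5 : (z - ε • 1) * b * (lnorm L x + ε • 1) = z - ε • 1 := by
      linear_combination (z - ε • (1 : L)) * hb
    rw [h5] at h4
    rw [smul_eq_mul_one ε (1 + m)]
    exact le_of_sub_eq (sub_nonneg.2 h4) (by ring)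

end Dual

end Norms

/-! ### Duality for spaces of vector-valued functions -/

section Duality

variable {L : Type*} [CommRing L] [ConditionallyCompleteLattice L] [IsOrderedRing L]
  [IsFAlgebra L] [Algebra ℝ L] [IsOrderedModule ℝ L] {k : ScalarKind}

/-- Positive linear combinations respect suprema: the suprema can be inserted one at a time. -/
theorem sum_mul_le_of_isLUB {I : Type*} (F : Finset I) {A : I → Set L} {m c : I → L} {K : L}
    (hm : ∀ i, IsLUB (A i) (m i)) (hA : ∀ i, (A i).Nonempty) (hc : ∀ i, 0 ≤ c i)
    (h : ∀ a : I → L, (∀ i, a i ∈ A i) → ∑ i ∈ F, c i * a i ≤ K) :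
    ∑ i ∈ F, c i * m i ≤ K := by
  classical
  induction F using Finset.induction_on generalizing K with
  | empty =>
    choose a ha using hA
    simpa using h a ha
  | insert i F hi ih =>
    rw [Finset.sum_insert hi, ← le_sub_iff_add_le]
    apply (isLUB_mul (hc i) (hA i) (hm i)).2
    rintro _ ⟨x, hx, rfl⟩
    simp only
    rw [le_sub_iff_add_le, ← le_sub_iff_add_le']
    refine ih fun a ha => ?_
    rw [le_sub_iff_add_le']
    have h1 := h (Function.update a i x) fun j => by
      rcases eq_or_ne j i with rfl | hj
      · simpa using hx
      · simpa [Function.update_of_ne hj] using ha j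
    rw [Finset.sum_insert hi, Function.update_self] at h1
    refine le_trans (le_of_eq ?_) h1
    congr 1
    refine Finset.sum_congr rfl fun j hj => ?_
    rw [Function.update_of_ne (ne_of_mem_of_not_mem hj hi)]

variable {S Y : Type*} [AddCommGroup Y] [Module (Scalar L k) Y] [LNorm L Y] [IsLNormedSpace L k Y]

/-- If the norm of `∑ ι s (z s)` is at most `K` whenever `‖z s‖ ≤ c s`, then testing a functional
`φ` on these sums bounds the norms of its components `φ ∘ ι s`. -/
theorem sum_mul_lnorm_le {X : Type*} [AddCommGroup X] [Module (Scalar L k) X] [LNorm L X]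
    (hX : ∀ x : X, 0 ≤ lnorm L x) {ι : S → Y →ₗ[Scalar L k] X} {φ : Dual L k X}
    {h : S → Dual L k Y} (hh : ∀ s y, h s y = φ (ι s y)) (F : Finset S) {c : S → L}
    (hc : ∀ s, 0 ≤ c s) {K : L}
    (hK : ∀ z : S → Y, (∀ s, lnorm L (z s) ≤ c s) → lnorm L (∑ s ∈ F, ι s (z s)) ≤ K) :
    ∑ s ∈ F, c s * lnorm L (h s) ≤ lnorm L φ * K := by
  have hφ := isBound_lnorm_of_nonneg hX φ
  refine sum_mul_le_of_isLUB F (fun s => isLUB_lnorm_dual (h s)) (fun s => ?_) hc fun a ha => ?_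
  · refine ⟨0, 0, by rw [lnorm_zero k]; exact zero_le_one, ?_⟩
    rw [map_zero (ofL k)]
    exact (h s).1.map_zero
  choose y hy hya using ha
  have h1 : φ.1 (∑ s ∈ F, ι s (ofL k (c s) • y s)) = ofL k (∑ s ∈ F, c s * a s) := by
    rw [map_sum, map_sum]
    refine Finset.sum_congr rfl fun s _ => ?_
    rw [map_smul, map_smul, smul_eq_mul, map_mul]
    congr 1
    exact (hh s (y s)).symm.trans (hya s)
  calc ∑ s ∈ F, c s * a s ≤ |∑ s ∈ F, c s * a s| := le_abs_self _
    _ = modulus L k (φ.1 (∑ s ∈ F, ι s (ofL k (c s) • y s))) := by rw [h1, modulus_ofL]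
    _ ≤ lnorm L φ * lnorm L (∑ s ∈ F, ι s (ofL k (c s) • y s)) := hφ.2 _
    _ ≤ lnorm L φ * K := by
      refine mul_le_mul_of_nonneg_left (hK _ fun s => ?_) hφ.1
      rw [IsLNormedSpace.smul, modulus_ofL_of_nonneg k (hc s)]
      simpa using mul_le_mul_of_nonneg_left (hy s) (hc s)

variable {V : Type*} [AddCommGroup V] [Module (Scalar L k) V] [LNorm L V]

/-- Let `X` and `W` be spaces of functions on `S` with values in `Y` and in `V ≅ Y*`. If Hölder's
inequality holds for `X` and `W`, every element of `X` is the sum of its components, and the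
components of every functional on `X` form an element of `W` that is not larger in norm, then `W`
is the dual of `X`. Here `ι s y` is the function that is `y` at `s` and zero elsewhere. -/
theorem exists_duality (J : LIsometryEquiv L k V (Dual L k Y))
    (X : Submodule (Scalar L k) (S → Y)) [LNorm L X] (W : Submodule (Scalar L k) (S → V))
    [LNorm L W] (hX : ∀ f : X, 0 ≤ lnorm L f) (hW : ∀ g : W, 0 ≤ lnorm L g)
    (ι : S → Y →ₗ[Scalar L k] X) (hι : ∀ s y, (ι s y).1 s = y)
    (hι' : ∀ s y t, t ≠ s → (ι s y).1 t = 0) (hιn : ∀ s y, lnorm L (ι s y) ≤ lnorm L y)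
    (holder : ∀ (f : X) (g : W) (F : Finset S),
      ∑ s ∈ F, lnorm L (g.1 s) * lnorm L (f.1 s) ≤ lnorm L g * lnorm L f)
    (dense : ∀ f : X, HasLSum L (fun s => ι s (f.1 s)) f)
    (conv : ∀ (φ : Dual L k X) (g : S → V),
      (∀ s y, J.toLinearEquiv (g s) y = φ (ι s y)) →
        ∃ h : g ∈ W, lnorm L (⟨g, h⟩ : W) ≤ lnorm L φ) :
    ∃ B : X →ₗ[Scalar L k] W →ₗ[Scalar L k] Scalar L k,
      (∀ f g, HasLSum L (fun s => J.toLinearEquiv (g.1 s) (f.1 s)) (B f g)) ∧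
      ∃ Φ : LIsometryEquiv L k W (Dual L k X), ∀ g f, Φ.toLinearEquiv g f = B f g := by
  have hbd : ∀ (f : X) (g : W) (F : Finset S),
      ∑ s ∈ F, modulus L k (J.toLinearEquiv (g.1 s) (f.1 s)) ≤ lnorm L g * lnorm L f := by
    intro f g F
    refine (Finset.sum_le_sum fun s _ => ?_).trans (holder f g F)
    have := (isBound_lnorm k (J.toLinearEquiv (g.1 s))).2 (f.1 s)
    rwa [show lnorm L (J.toLinearEquiv (g.1 s)) = lnorm L (g.1 s) from J.lnorm_map _] at this
  choose β hβ using fun f g => exists_hasLSum (hbd f g)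
  have uniq : ∀ {f : X} {g : W} {σ : Scalar L k},
      HasLSum L (fun s => J.toLinearEquiv (g.1 s) (f.1 s)) σ → β f g = σ :=
    fun h => (hβ _ _).unique k h
  let B : X →ₗ[Scalar L k] W →ₗ[Scalar L k] Scalar L k := LinearMap.mk₂ _ β
    (fun f f' g => uniq <| by
      have e : (fun s => J.toLinearEquiv (g.1 s) ((f + f').1 s)) = fun s =>
          J.toLinearEquiv (g.1 s) (f.1 s) + J.toLinearEquiv (g.1 s) (f'.1 s) :=
        funext fun s => (J.toLinearEquiv (g.1 s)).1.map_add _ _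
      rw [e]
      exact (hβ f g).add k (hβ f' g))
    (fun c f g => uniq <| by
      have e : (fun s => J.toLinearEquiv (g.1 s) ((c • f).1 s)) = fun s =>
          c • J.toLinearEquiv (g.1 s) (f.1 s) :=
        funext fun s => (J.toLinearEquiv (g.1 s)).1.map_smul _ _
      rw [e]
      exact (hβ f g).smul c)
    (fun f g g' => uniq <| by
      have e : (fun s => J.toLinearEquiv ((g + g').1 s) (f.1 s)) = fun s =>
          J.toLinearEquiv (g.1 s) (f.1 s) + J.toLinearEquiv (g'.1 s) (f.1 s) :=
        funext fun s => congrArg (fun ψ : Dual L k Y => ψ (f.1 s))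
          (J.toLinearEquiv.map_add (g.1 s) (g'.1 s))
      rw [e]
      exact (hβ f g).add k (hβ f g'))
    (fun c f g => uniq <| by
      have e : (fun s => J.toLinearEquiv ((c • g).1 s) (f.1 s)) = fun s =>
          c • J.toLinearEquiv (g.1 s) (f.1 s) :=
        funext fun s => congrArg (fun ψ : Dual L k Y => ψ (f.1 s))
          (J.toLinearEquiv.map_smul c (g.1 s))
      rw [e]
      exact (hβ f g).smul c)
  have hB : ∀ f g, HasLSum L (fun s => J.toLinearEquiv (g.1 s) (f.1 s)) (B f g) := hβ
  have bound : ∀ g, IsBound L k (B.flip g) (lnorm L g) := fun g =>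
    ⟨hW g, fun f => (hB f g).lnorm_le k (hbd f g)⟩
  let Ψ : W →ₗ[Scalar L k] Dual L k X :=
    B.flip.codRestrict (dualSubmodule L k X) fun g => ⟨_, bound g⟩
  have hΨ : ∀ g f, Ψ g f = B f g := fun g f => rfl
  have hBι : ∀ g s y, B (ι s y) g = J.toLinearEquiv (g.1 s) y := by
    intro g s y
    refine uniq ?_
    have := hasLSum_single (L := L) k (u := fun t => J.toLinearEquiv (g.1 t) ((ι s y).1 t)) s
      fun t ht => by rw [hι' s y t ht]; exact (J.toLinearEquiv (g.1 t)).1.map_zero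
    simpa only [hι] using this
  -- Every functional has components `g s`, and they form an element of `W`.
  have back : ∀ φ : Dual L k X, ∃ g : W, (∀ s y, J.toLinearEquiv (g.1 s) y = φ (ι s y)) ∧
      lnorm L g ≤ lnorm L φ := by
    intro φ
    have hφ := isBound_lnorm_of_nonneg hX φ
    let h : S → Dual L k Y := fun s => ⟨φ.1 ∘ₗ ι s, lnorm L φ, hφ.1, fun y =>
      (hφ.2 (ι s y)).trans (mul_le_mul_of_nonneg_left (hιn s y) hφ.1)⟩
    have hJ : ∀ s y, J.toLinearEquiv (J.toLinearEquiv.symm (h s)) y = φ (ι s y) := fun s y => by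
      rw [LinearEquiv.apply_symm_apply]; rfl
    obtain ⟨hg, hle⟩ := conv φ (fun s => J.toLinearEquiv.symm (h s)) hJ
    exact ⟨⟨_, hg⟩, hJ, hle⟩
  have comp : ∀ (g g' : W), (∀ s y, J.toLinearEquiv (g.1 s) y = J.toLinearEquiv (g'.1 s) y) →
      g = g' := by
    intro g g' h
    refine Subtype.ext (funext fun s => J.toLinearEquiv.injective (DFunLike.ext _ _ (h s)))
  have inj : Function.Injective Ψ := fun g g' h => comp g g' fun s y => by
    rw [← hBι, ← hBι, ← hΨ, ← hΨ, h]
  have surj : Function.Surjective Ψ := by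
    intro φ
    obtain ⟨g, hg, -⟩ := back φ
    have hφ := isBound_lnorm_of_nonneg hX φ
    refine ⟨g, DFunLike.ext _ _ fun f => (hΨ g f).trans (uniq ?_)⟩
    -- `φ` is continuous, so it is determined by its components.
    obtain ⟨E, hE, h⟩ := dense f
    refine ⟨_, isGLB_mul_zero hφ.1 hE, ?_⟩
    rintro _ ⟨ε, hε, rfl⟩
    obtain ⟨F₀, hF⟩ := h ε hε
    refine ⟨F₀, fun F hF' => ?_⟩
    have e : ∑ s ∈ F, J.toLinearEquiv (g.1 s) (f.1 s) - φ f =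
        φ.1 (∑ s ∈ F, ι s (f.1 s) - f) := by
      rw [map_sub, map_sum]
      exact congrArg (· - φ.1 f) (Finset.sum_congr rfl fun s _ => hg s (f.1 s))
    change modulus L k (∑ s ∈ F, J.toLinearEquiv (g.1 s) (f.1 s) - φ f) ≤ _
    rw [e]
    exact (hφ.2 _).trans (mul_le_mul_of_nonneg_left (hF F hF') hφ.1)
  refine ⟨B, hB, ⟨LinearEquiv.ofBijective Ψ ⟨inj, surj⟩, fun g => ?_⟩, hΨ⟩
  change lnorm L (Ψ g) = lnorm L g
  apply le_antisymm
  · exact (lnorm_dual_isGLB k (Ψ g)).1 (bound g)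
  · obtain ⟨g', hg', hle⟩ := back (Ψ g)
    rwa [comp g' g fun s y => by rw [hg', hΨ, hBι]] at hle

end Duality

section Sequence

variable {L : Type*} [CommRing L] [ConditionallyCompleteLattice L] [IsOrderedRing L]
  [IsFAlgebra L] [Algebra ℝ L] [IsOrderedModule ℝ L] {k : ScalarKind}
  {S Y : Type*} [AddCommGroup Y] [Module (Scalar L k) Y] [LNorm L Y] [IsLNormedSpace L k Y]

/-! ### The functions supported at one point -/

open Classical in
/-- The map that sends `y` to the function with value `y` at `s` and zero elsewhere, into a space of
functions that contains these functions. -/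
def singleMap (X : Submodule (Scalar L k) (S → Y)) (h : ∀ s y, Pi.single s y ∈ X) (s : S) :
    Y →ₗ[Scalar L k] X :=
  (LinearMap.single (Scalar L k) (fun _ : S => Y) s).codRestrict X (h s)

section SingleMap

open Classical in
theorem mem_of_support {X : Submodule (Scalar L k) (S → Y)}
    (h : ∀ (f : S → Y) (s : S), (∀ t, t ≠ s → f t = 0) → f ∈ X) (s : S) (y : Y) :
    Pi.single s y ∈ X :=
  h _ s fun _ ht => Pi.single_eq_of_ne (M := fun _ : S => Y) ht y

variable {X : Submodule (Scalar L k) (S → Y)}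

open Classical in
theorem singleMap_same (h : ∀ s y, Pi.single s y ∈ X) (s : S) (y : Y) :
    (singleMap X h s y).1 s = y := Pi.single_eq_same (M := fun _ : S => Y) s y

open Classical in
theorem singleMap_ne (h : ∀ s y, Pi.single s y ∈ X) (s : S) (y : Y) (t : S) (ht : t ≠ s) :
    (singleMap X h s y).1 t = 0 := Pi.single_eq_of_ne (M := fun _ : S => Y) ht y

open Classical in
theorem sum_singleMap_of_mem (h : ∀ s y, Pi.single s y ∈ X) {F : Finset S} (z : S → Y) {t : S}
    (ht : t ∈ F) : (∑ s ∈ F, singleMap X h s (z s)).1 t = z t := by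
  rw [AddSubmonoidClass.coe_finsetSum, Finset.sum_apply, Finset.sum_eq_single t]
  · exact singleMap_same h t (z t)
  · exact fun s _ hs => singleMap_ne h s (z s) t hs.symm
  · exact fun h => absurd ht h

open Classical in
theorem sum_singleMap_of_notMem (h : ∀ s y, Pi.single s y ∈ X) {F : Finset S} (z : S → Y) {t : S}
    (ht : t ∉ F) : (∑ s ∈ F, singleMap X h s (z s)).1 t = 0 := by
  rw [AddSubmonoidClass.coe_finsetSum, Finset.sum_apply]
  exact Finset.sum_eq_zero fun s hs => singleMap_ne h s (z s) t fun h => ht (h ▸ hs)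

end SingleMap

/-! ### Norms in `ℓ^p` and `c₀` -/

theorem rpow_lnorm_nonneg (k : ScalarKind) [Module (Scalar L k) Y] [IsLNormedSpace L k Y]
    (f : S → Y) {p : ℝ} (hp : 0 ≤ p) (s : S) :
    0 ≤ rpow (lnorm L (f s)) p :=
  rpow_nonneg (IsLNormedSpace.nonneg k (f s)) hp

theorem sum_rpow_lnorm_le_of_support (k : ScalarKind) [Module (Scalar L k) Y] [IsLNormedSpace L k Y]
    {p : ℝ} (hp : 0 < p) {f : S → Y} {F : Finset S}
    (hf : ∀ t, t ∉ F → f t = 0) (G : Finset S) :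
    ∑ s ∈ G, rpow (lnorm L (f s)) p ≤ ∑ s ∈ F, rpow (lnorm L (f s)) p := by
  classical
  have h0 := rpow_lnorm_nonneg (L := L) k f hp.le
  calc ∑ s ∈ G, rpow (lnorm L (f s)) p ≤ ∑ s ∈ F ∪ G, rpow (lnorm L (f s)) p :=
        Finset.sum_le_sum_of_subset_of_nonneg Finset.subset_union_right fun s _ _ => h0 s
    _ = ∑ s ∈ F, rpow (lnorm L (f s)) p := by
        refine (Finset.sum_subset Finset.subset_union_left fun s _ hs => ?_).symm
        rw [hf s hs, lnorm_zero k, rpow_zero_left hp]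

section LpNorm

variable {p : ℝ≥0∞}

theorem memlp_of_sum_le (k : ScalarKind) [Module (Scalar L k) Y] [IsLNormedSpace L k Y]
    (hp : p ≠ ∞) {f : S → Y} {M : L}
    (h : ∀ F : Finset S, ∑ s ∈ F, rpow (lnorm L (f s)) p.toReal ≤ M) : Memlp L p f := by
  refine ⟨fun h => absurd h hp, fun _ => ?_⟩
  rw [summable_iff_bddAbove (rpow_lnorm_nonneg k f ENNReal.toReal_nonneg)]
  exact ⟨M, by rintro _ ⟨F, rfl⟩; exact h F⟩

variable [hp1 : Fact (1 ≤ p)]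

theorem toReal_pos_of_ne_top (hp : p ≠ ∞) : 0 < p.toReal :=
  ENNReal.toReal_pos (one_pos.trans_le hp1.1).ne' hp

theorem isLUB_sum_rpow (hp : p ≠ ∞) (f : lp L k S Y p) :
    IsLUB (Set.range fun F : Finset S => ∑ s ∈ F, rpow (lnorm L (f.1 s)) p.toReal)
      (sSup (Set.range fun F : Finset S => ∑ s ∈ F, rpow (lnorm L (f.1 s)) p.toReal)) :=
  isLUB_csSup (Set.range_nonempty _) ((summable_iff_bddAbove
    (rpow_lnorm_nonneg k f.1 ENNReal.toReal_nonneg)).1 (f.2.2 hp))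

theorem lnorm_lp (hp : p ≠ ∞) (f : lp L k S Y p) :
    lnorm L f = rpow (sSup (Set.range fun F : Finset S =>
      ∑ s ∈ F, rpow (lnorm L (f.1 s)) p.toReal)) (1 / p.toReal) :=
  if_neg hp

theorem sum_rpow_nonneg (hp : p ≠ ∞) (f : lp L k S Y p) :
    0 ≤ sSup (Set.range fun F : Finset S => ∑ s ∈ F, rpow (lnorm L (f.1 s)) p.toReal) :=
  (isLUB_sum_rpow hp f).1 ⟨∅, Finset.sum_empty⟩

theorem lnorm_lp_nonneg (hp : p ≠ ∞) (f : lp L k S Y p) : 0 ≤ lnorm L f := by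
  rw [lnorm_lp hp]
  exact rpow_nonneg (sum_rpow_nonneg hp f) (one_div_nonneg.2 ENNReal.toReal_nonneg)

theorem lnorm_lp_le (hp : p ≠ ∞) {f : lp L k S Y p} {M : L}
    (h : ∀ F : Finset S, ∑ s ∈ F, rpow (lnorm L (f.1 s)) p.toReal ≤ M) :
    lnorm L f ≤ rpow M (1 / p.toReal) := by
  rw [lnorm_lp hp]
  refine rpow_mono (sum_rpow_nonneg hp f) ((isLUB_sum_rpow hp f).2 ?_)
    (one_div_nonneg.2 ENNReal.toReal_nonneg)
  rintro _ ⟨F, rfl⟩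
  exact h F

theorem rpow_sum_le_lnorm_lp (hp : p ≠ ∞) (f : lp L k S Y p) (F : Finset S) :
    rpow (∑ s ∈ F, rpow (lnorm L (f.1 s)) p.toReal) (1 / p.toReal) ≤ lnorm L f := by
  rw [lnorm_lp hp]
  exact rpow_mono (Finset.sum_nonneg fun s _ =>
      rpow_lnorm_nonneg k f.1 ENNReal.toReal_nonneg s)
    ((isLUB_sum_rpow hp f).1 ⟨F, rfl⟩) (one_div_nonneg.2 ENNReal.toReal_nonneg)

theorem sum_rpow_one (k : ScalarKind) [Module (Scalar L k) Y] [IsLNormedSpace L k Y]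
    (f : S → Y) (F : Finset S) :
    ∑ s ∈ F, rpow (lnorm L (f s)) (1 : ℝ≥0∞).toReal = ∑ s ∈ F, lnorm L (f s) :=
  Finset.sum_congr rfl fun s _ => by
    rw [ENNReal.toReal_one, rpow_one (IsLNormedSpace.nonneg k (f s))]

theorem sum_lnorm_le_lnorm_lp_one (f : lp L k S Y 1) (F : Finset S) :
    ∑ s ∈ F, lnorm L (f.1 s) ≤ lnorm L f := by
  have := rpow_sum_le_lnorm_lp ENNReal.one_ne_top f F
  rwa [sum_rpow_one k, ENNReal.toReal_one, one_div_one,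
    rpow_one (Finset.sum_nonneg fun s _ => IsLNormedSpace.nonneg k (f.1 s))] at this

theorem exists_mem_lp_one {f : S → Y} {M : L} (h : ∀ F : Finset S, ∑ s ∈ F, lnorm L (f s) ≤ M) :
    ∃ hf : f ∈ lp L k S Y 1, lnorm L (⟨f, hf⟩ : lp L k S Y 1) ≤ M := by
  have h' : ∀ F : Finset S, ∑ s ∈ F, rpow (lnorm L (f s)) (1 : ℝ≥0∞).toReal ≤ M := fun F => by
    rw [sum_rpow_one k]
    exact h F
  refine ⟨memlp_of_sum_le k ENNReal.one_ne_top h', ?_⟩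
  have hM : 0 ≤ M := by simpa using h ∅
  have := lnorm_lp_le (k := k) ENNReal.one_ne_top (f := ⟨f, memlp_of_sum_le k
    ENNReal.one_ne_top h'⟩) h'
  rwa [ENNReal.toReal_one, one_div_one, rpow_one hM] at this

theorem lp_single_mem (hp : p ≠ ∞) (f : S → Y) (s : S) (hf : ∀ t, t ≠ s → f t = 0) :
    f ∈ lp L k S Y p :=
  memlp_of_sum_le k hp (sum_rpow_lnorm_le_of_support k (toReal_pos_of_ne_top hp)
    (F := {s}) fun t ht => hf t (by simpa using ht))

theorem lnorm_lp_le_of_support (hp : p ≠ ∞) {f : lp L k S Y p} {F : Finset S}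
    (hf : ∀ t, t ∉ F → f.1 t = 0) {c : S → L} (hc : ∀ t ∈ F, lnorm L (f.1 t) ≤ c t) :
    lnorm L f ≤ rpow (∑ s ∈ F, rpow (c s) p.toReal) (1 / p.toReal) :=
  lnorm_lp_le hp fun G =>
    (sum_rpow_lnorm_le_of_support k (toReal_pos_of_ne_top hp) hf G).trans
      (Finset.sum_le_sum fun s hs => rpow_mono (IsLNormedSpace.nonneg k _) (hc s hs)
        ENNReal.toReal_nonneg)

open Classical in
theorem lnorm_singleMap_le (hp : p ≠ ∞) (h : ∀ s y, Pi.single s y ∈ lp L k S Y p) (s : S) (y : Y) :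
    lnorm L (singleMap _ h s y) ≤ lnorm L y := by
  have h1 := lnorm_lp_le_of_support hp (f := singleMap _ h s y) (F := {s})
    (fun t ht => singleMap_ne h s y t (by simpa using ht)) (c := fun _ => lnorm L y)
    (fun t ht => by rw [Finset.mem_singleton.1 ht, singleMap_same])
  rwa [Finset.sum_singleton, rpow_rpow_one_div (IsLNormedSpace.nonneg k y)
    (toReal_pos_of_ne_top hp)] at h1

open Classical in
/-- The functions with finite support are dense in `ℓ^p`: the tails of `∑ ‖f s‖ ^ p` decrease to
zero, and so do their `1 / p`-th powers because the power function is an order isomorphism. -/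
theorem hasLSum_singleMap_lp (hp : p ≠ ∞) (h : ∀ s y, Pi.single s y ∈ lp L k S Y p)
    (f : lp L k S Y p) : HasLSum L (fun s => singleMap _ h s (f.1 s)) f := by
  have hp0 := toReal_pos_of_ne_top hp
  have hσ := isLUB_sum_rpow hp f
  set σ := sSup (Set.range fun F : Finset S => ∑ s ∈ F, rpow (lnorm L (f.1 s)) p.toReal)
  have hr : ∀ F : Finset S, 0 ≤ σ - ∑ s ∈ F, rpow (lnorm L (f.1 s)) p.toReal := fun F =>
    sub_nonneg.2 (hσ.1 ⟨F, rfl⟩)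
  refine ⟨Set.range fun F : Finset S =>
    rpow (σ - ∑ s ∈ F, rpow (lnorm L (f.1 s)) p.toReal) (1 / p.toReal), ⟨?_, fun z hz => ?_⟩, ?_⟩
  · rintro _ ⟨F, rfl⟩
    exact rpow_nonneg (hr F) (one_div_pos.2 hp0).le
  · have hz0 := posPart_nonneg z
    have h1 : rpow z⁺ p.toReal ≤ 0 := by
      have h2 : σ ≤ σ - rpow z⁺ p.toReal := by
        apply hσ.2
        rintro _ ⟨F, rfl⟩
        rw [le_sub_comm]
        have h3 : z⁺ ≤ rpow (σ - ∑ s ∈ F, rpow (lnorm L (f.1 s)) p.toReal) (1 / p.toReal) :=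
          sup_le (hz ⟨F, rfl⟩) (rpow_nonneg (hr F) (one_div_pos.2 hp0).le)
        have h4 := rpow_mono hz0 h3 hp0.le
        rwa [rpow_one_div_rpow (hr F) hp0] at h4
      simpa using le_sub_iff_add_le.1 h2
    have h5 := rpow_rpow_one_div hz0 hp0
    rw [le_antisymm h1 (rpow_nonneg hz0 hp0.le), rpow_zero_left (one_div_pos.2 hp0)] at h5
    exact (le_posPart z).trans h5.ge
  · rintro _ ⟨F₀, rfl⟩
    refine ⟨F₀, fun F hF => lnorm_lp_le hp fun G => ?_⟩
    have h0 := rpow_lnorm_nonneg (L := L) k f.1 hp0.le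
    have hterm : ∀ s, rpow (lnorm L ((∑ s ∈ F, singleMap _ h s (f.1 s) - f).1 s)) p.toReal ≤
        if s ∈ F₀ then 0 else rpow (lnorm L (f.1 s)) p.toReal := by
      intro s
      change rpow (lnorm L ((∑ s ∈ F, singleMap _ h s (f.1 s)).1 s - f.1 s)) p.toReal ≤ _
      by_cases hs : s ∈ F
      · rw [sum_singleMap_of_mem h f.1 hs, sub_self, lnorm_zero k, rpow_zero_left hp0]
        split_ifs
        · exact le_rfl
        · exact h0 s
      · rw [sum_singleMap_of_notMem h f.1 hs, zero_sub, lnorm_neg k, if_neg fun hs' => hs (hF hs')]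
    refine (Finset.sum_le_sum fun s _ => hterm s).trans ?_
    rw [Finset.sum_ite, Finset.sum_const_zero, zero_add, le_sub_iff_add_le, ← Finset.sum_union]
    · exact hσ.1 ⟨_, rfl⟩
    · exact Finset.disjoint_left.2 fun s hs => (Finset.mem_filter.1 hs).2

end LpNorm

/-- The components `φ ∘ ι` of a functional `φ` do not exceed `φ` in norm. -/
theorem lnorm_component_le {X : Type*} [AddCommGroup X] [Module (Scalar L k) X] [LNorm L X]
    (hX : ∀ x : X, 0 ≤ lnorm L x) {ι : Y →ₗ[Scalar L k] X} (hι : ∀ y, lnorm L (ι y) ≤ lnorm L y)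
    {φ : Dual L k X} {h : Dual L k Y} (hh : ∀ y, h y = φ (ι y)) : lnorm L h ≤ lnorm L φ := by
  have hφ := isBound_lnorm_of_nonneg hX φ
  refine (lnorm_dual_isGLB k h).1 ⟨hφ.1, fun y => ?_⟩
  have h1 := (hφ.2 (ι y)).trans (mul_le_mul_of_nonneg_left (hι y) hφ.1)
  rwa [show φ.1 (ι y) = h.1 y from (hh y).symm] at h1

section Bounded

variable [Nonempty S]

theorem isLUB_lnorm {f : S → Y} (hf : Memlp L ∞ f) :
    IsLUB (Set.range fun s => lnorm L (f s)) (sSup (Set.range fun s => lnorm L (f s))) := by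
  obtain ⟨M, -, hM⟩ := hf.1 rfl
  exact isLUB_csSup (Set.range_nonempty _) ⟨M, by rintro _ ⟨s, rfl⟩; exact hM s⟩

theorem lnorm_lp_of_eq_top {p : ℝ≥0∞} [Fact (1 ≤ p)] (hp : p = ∞) (g : lp L k S Y p) :
    lnorm L g = sSup (Set.range fun s => lnorm L (g.1 s)) :=
  if_pos hp

theorem lnorm_lp_top (g : lp L k S Y ∞) :
    lnorm L g = sSup (Set.range fun s => lnorm L (g.1 s)) :=
  lnorm_lp_of_eq_top rfl g

theorem lnorm_lp_top_nonneg (g : lp L k S Y ∞) : 0 ≤ lnorm L g := by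
  rw [lnorm_lp_top]
  exact (IsLNormedSpace.nonneg k _).trans ((isLUB_lnorm g.2).1 ⟨Classical.arbitrary S, rfl⟩)

theorem lnorm_le_lnorm_c0 (f : c0 L k S Y) (s : S) : lnorm L (f.1 s) ≤ lnorm L f :=
  (isLUB_lnorm f.2.1).1 ⟨s, rfl⟩

theorem lnorm_c0_le {f : c0 L k S Y} {M : L} (h : ∀ s, lnorm L (f.1 s) ≤ M) : lnorm L f ≤ M :=
  (isLUB_lnorm f.2.1).2 (by rintro _ ⟨s, rfl⟩; exact h s)

theorem lnorm_c0_nonneg (f : c0 L k S Y) : 0 ≤ lnorm L f :=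
  (IsLNormedSpace.nonneg k _).trans (lnorm_le_lnorm_c0 f (Classical.arbitrary S))

theorem c0_single_mem (f : S → Y) (s : S) (hf : ∀ t, t ≠ s → f t = 0) : f ∈ c0 L k S Y := by
  refine ⟨⟨fun _ => ⟨lnorm L (f s), IsLNormedSpace.nonneg k _, fun t => ?_⟩,
    fun h => absurd rfl h⟩, {0}, isGLB_singleton, ?_⟩
  · rcases eq_or_ne t s with rfl | ht
    · exact le_rfl
    · rw [hf t ht, lnorm_zero k]
      exact IsLNormedSpace.nonneg k _
  · rintro _ rfl
    refine ⟨{s}ᶜ, by simp, fun t ht => ?_⟩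
    rw [hf t ht, lnorm_zero k]

end Bounded

/-! ### The dual spaces -/

variable {V : Type*} [AddCommGroup V] [Module (Scalar L k) V] [LNorm L V] [IsLNormedSpace L k V]
  (J : LIsometryEquiv L k V (Dual L k Y))

theorem lnorm_toLinearEquiv (v : V) : lnorm L (J.toLinearEquiv v) = lnorm L v := J.lnorm_map v

/-- The dual of `ℓ¹` is `ℓ^∞`. -/
theorem exists_duality_lp_one [Nonempty S] [Fact ((1 : ℝ≥0∞) ≤ ∞)] :
    ∃ B : lp L k S Y 1 →ₗ[Scalar L k] lp L k S V ∞ →ₗ[Scalar L k] Scalar L k,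
      (∀ f g, HasLSum L (fun s => J.toLinearEquiv (g.1 s) (f.1 s)) (B f g)) ∧
      ∃ Φ : LIsometryEquiv L k (lp L k S V ∞) (Dual L k (lp L k S Y 1)),
        ∀ g f, Φ.toLinearEquiv g f = B f g := by
  classical
  have h1 := ENNReal.one_ne_top
  have hmem := mem_of_support (lp_single_mem (L := L) (k := k) (S := S) (Y := Y) h1)
  refine exists_duality J _ _ (lnorm_lp_nonneg h1) lnorm_lp_top_nonneg (singleMap _ hmem)
    (singleMap_same hmem) (singleMap_ne hmem) (lnorm_singleMap_le h1 hmem) ?_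
    (hasLSum_singleMap_lp h1 hmem) ?_
  · intro f g F
    calc ∑ s ∈ F, lnorm L (g.1 s) * lnorm L (f.1 s)
        ≤ ∑ s ∈ F, lnorm L g * lnorm L (f.1 s) := Finset.sum_le_sum fun s _ =>
          mul_le_mul_of_nonneg_right (by
            rw [lnorm_lp_top]
            exact (isLUB_lnorm g.2).1 ⟨s, rfl⟩) (IsLNormedSpace.nonneg k _)
      _ = lnorm L g * ∑ s ∈ F, lnorm L (f.1 s) := by rw [Finset.mul_sum]
      _ ≤ _ := mul_le_mul_of_nonneg_left (sum_lnorm_le_lnorm_lp_one f F) (lnorm_lp_top_nonneg g)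
  · intro φ g hg
    have hφ := isBound_lnorm_of_nonneg (lnorm_lp_nonneg h1) φ
    have hle : ∀ s, lnorm L (g s) ≤ lnorm L φ := fun s => by
      rw [← lnorm_toLinearEquiv J]
      exact lnorm_component_le (lnorm_lp_nonneg h1) (lnorm_singleMap_le h1 hmem s) (hg s)
    have hm : Memlp L ∞ g := ⟨fun _ => ⟨_, hφ.1, hle⟩, fun h => absurd rfl h⟩
    refine ⟨hm, ?_⟩
    rw [lnorm_lp_top]
    exact (isLUB_lnorm hm).2 (by rintro _ ⟨s, rfl⟩; exact hle s)

/-- The dual of `ℓ^p` is `ℓ^q` for `1 < p < ∞`. -/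
theorem exists_duality_lp_of_ne_top {p q : ℝ≥0∞} [Fact (1 ≤ p)] [Fact (1 ≤ q)] (hp : p ≠ ∞)
    (hq : q ≠ ∞) (hpq : p.toReal.HolderConjugate q.toReal) :
    ∃ B : lp L k S Y p →ₗ[Scalar L k] lp L k S V q →ₗ[Scalar L k] Scalar L k,
      (∀ f g, HasLSum L (fun s => J.toLinearEquiv (g.1 s) (f.1 s)) (B f g)) ∧
      ∃ Φ : LIsometryEquiv L k (lp L k S V q) (Dual L k (lp L k S Y p)),
        ∀ g f, Φ.toLinearEquiv g f = B f g := by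
  classical
  have hmem := mem_of_support (lp_single_mem (L := L) (k := k) (S := S) (Y := Y) hp)
  have hp0 := hpq.pos
  have hq0 := hpq.symm.pos
  have hq1 : 0 < q.toReal - 1 := hpq.symm.sub_one_pos
  refine exists_duality J _ _ (lnorm_lp_nonneg hp) (lnorm_lp_nonneg hq) (singleMap _ hmem)
    (singleMap_same hmem) (singleMap_ne hmem) (lnorm_singleMap_le hp hmem) ?_
    (hasLSum_singleMap_lp hp hmem) ?_
  · intro f g F
    have h0 := rpow_sum_le_lnorm_lp hp f F
    refine (sum_mul_le_rpow_mul_rpow F (fun s => IsLNormedSpace.nonneg k (g.1 s))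
      (fun s => IsLNormedSpace.nonneg k (f.1 s)) hpq.symm).trans
      (mul_le_mul (rpow_sum_le_lnorm_lp hq g F) h0 ?_ (lnorm_lp_nonneg hq g))
    exact rpow_nonneg (Finset.sum_nonneg fun s _ => rpow_lnorm_nonneg k f.1 hp0.le s)
      (one_div_pos.2 hp0).le
  · intro φ g hg
    have hφ := isBound_lnorm_of_nonneg (lnorm_lp_nonneg hp) φ
    have hn : ∀ s, 0 ≤ lnorm L (g s) := fun s => IsLNormedSpace.nonneg k (g s)
    have hle : ∀ F : Finset S,
        ∑ s ∈ F, rpow (lnorm L (g s)) q.toReal ≤ rpow (lnorm L φ) q.toReal := by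
      intro F
      refine le_rpow_of_le_mul_rpow (Finset.sum_nonneg fun s _ => rpow_nonneg (hn s) hq0.le)
        hφ.1 hpq ?_
      -- Equality holds in Hölder's inequality for the weights `‖g s‖ ^ (q - 1)`.
      have h1 := sum_mul_lnorm_le (lnorm_lp_nonneg hp) hg F
        (c := fun s => rpow (lnorm L (g s)) (q.toReal - 1))
        (K := rpow (∑ s ∈ F, rpow (rpow (lnorm L (g s)) (q.toReal - 1)) p.toReal) (1 / p.toReal))
        (fun s => rpow_nonneg (hn s) hq1.le)
        fun z hz => lnorm_lp_le_of_support hp (fun t ht => sum_singleMap_of_notMem hmem z ht)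
          fun t ht => by rw [sum_singleMap_of_mem hmem z ht]; exact hz t
      have e1 : ∀ s, rpow (lnorm L (g s)) (q.toReal - 1) * lnorm L (J.toLinearEquiv (g s)) =
          rpow (lnorm L (g s)) q.toReal := fun s => by
        rw [lnorm_toLinearEquiv]
        have := rpow_mul_rpow (hn s) hq1 one_pos
        rwa [rpow_one (hn s), sub_add_cancel] at this
      have e2 : ∀ s, rpow (rpow (lnorm L (g s)) (q.toReal - 1)) p.toReal =
          rpow (lnorm L (g s)) q.toReal := fun s => by
        rw [rpow_rpow (hn s) hq1 hp0, hpq.symm.sub_one_mul_conj]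
      simp only [e1, e2] at h1
      exact h1
    refine ⟨memlp_of_sum_le k hq hle, ?_⟩
    have := lnorm_lp_le (k := k) hq (f := ⟨g, memlp_of_sum_le k hq hle⟩) hle
    rwa [rpow_rpow_one_div hφ.1 hq0] at this

theorem exists_duality_lp [Nonempty S] {p q : ℝ≥0∞} [Fact (1 ≤ p)] [Fact (1 ≤ q)] (hp : p ≠ ∞)
    (hpq : p⁻¹ + q⁻¹ = 1) :
    ∃ B : lp L k S Y p →ₗ[Scalar L k] lp L k S V q →ₗ[Scalar L k] Scalar L k,
      (∀ f g, HasLSum L (fun s => J.toLinearEquiv (g.1 s) (f.1 s)) (B f g)) ∧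
      ∃ Φ : LIsometryEquiv L k (lp L k S V q) (Dual L k (lp L k S Y p)),
        ∀ g f, Φ.toLinearEquiv g f = B f g := by
  have : ENNReal.HolderConjugate p q := ENNReal.holderConjugate_iff.2 hpq
  by_cases hq : q = ∞
  · subst hq
    have hp1 : p = 1 := by simpa using hpq
    subst hp1
    exact exists_duality_lp_one J
  · refine exists_duality_lp_of_ne_top J hp hq ?_
    exact ENNReal.HolderConjugate.toReal_of_ne_top hp hq

/-- The dual of `c₀` is `ℓ¹`. -/
theorem exists_duality_c0 [Nonempty S] :
    ∃ B : c0 L k S Y →ₗ[Scalar L k] lp L k S V 1 →ₗ[Scalar L k] Scalar L k,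
      (∀ f g, HasLSum L (fun s => J.toLinearEquiv (g.1 s) (f.1 s)) (B f g)) ∧
      ∃ Φ : LIsometryEquiv L k (lp L k S V 1) (Dual L k (c0 L k S Y)),
        ∀ g f, Φ.toLinearEquiv g f = B f g := by
  classical
  have hmem := mem_of_support (c0_single_mem (L := L) (k := k) (S := S) (Y := Y))
  refine exists_duality J _ _ lnorm_c0_nonneg (lnorm_lp_nonneg ENNReal.one_ne_top)
    (singleMap _ hmem) (singleMap_same hmem) (singleMap_ne hmem) ?_ ?_ ?_ ?_
  · intro s y
    refine lnorm_c0_le fun t => ?_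
    rcases eq_or_ne t s with rfl | ht
    · rw [singleMap_same]
    · rw [singleMap_ne hmem s y t ht, lnorm_zero k]
      exact IsLNormedSpace.nonneg k y
  · intro f g F
    calc ∑ s ∈ F, lnorm L (g.1 s) * lnorm L (f.1 s)
        ≤ ∑ s ∈ F, lnorm L (g.1 s) * lnorm L f := Finset.sum_le_sum fun s _ =>
          mul_le_mul_of_nonneg_left (lnorm_le_lnorm_c0 f s) (IsLNormedSpace.nonneg k _)
      _ = (∑ s ∈ F, lnorm L (g.1 s)) * lnorm L f := by rw [Finset.sum_mul]
      _ ≤ _ := mul_le_mul_of_nonneg_right (sum_lnorm_le_lnorm_lp_one g F) (lnorm_c0_nonneg f)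
  · intro f
    obtain ⟨-, E, hE, h⟩ := f.2
    refine ⟨E, hE, fun ε hε => ?_⟩
    obtain ⟨C, hC, hCf⟩ := h ε hε
    have hε0 : 0 ≤ ε := hE.1 hε
    refine ⟨hC.toFinset, fun F hF => lnorm_c0_le fun t => ?_⟩
    change lnorm L ((∑ s ∈ F, singleMap _ hmem s (f.1 s)).1 t - f.1 t) ≤ ε
    by_cases ht : t ∈ F
    · rwa [sum_singleMap_of_mem hmem f.1 ht, sub_self, lnorm_zero k]
    · rw [sum_singleMap_of_notMem hmem f.1 ht, zero_sub, lnorm_neg k]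
      refine hCf t (by_contra fun h => ht (hF ?_))
      simpa using h
  · intro φ g hg
    refine exists_mem_lp_one fun F => ?_
    have h1 := sum_mul_lnorm_le lnorm_c0_nonneg hg F (c := fun _ => 1) (K := 1)
      (fun _ => zero_le_one) fun z hz => lnorm_c0_le fun t => by
        by_cases ht : t ∈ F
        · rw [sum_singleMap_of_mem hmem z ht]
          exact hz t
        · rw [sum_singleMap_of_notMem hmem z ht, lnorm_zero k]
          exact zero_le_one
    simpa only [one_mul, mul_one, lnorm_toLinearEquiv] using h1

variable (L k) in
/-- The scalars are their own dual space: `v` is the functional `x ↦ x * v`. -/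
def scalarDual : LIsometryEquiv L k (Scalar L k) (Dual L k (Scalar L k)) where
  toFun v := ⟨LinearMap.toSpanSingleton (Scalar L k) (Scalar L k) v, modulus L k v,
    modulus_nonneg k v, fun x => by
      rw [LinearMap.toSpanSingleton_apply, smul_eq_mul, modulus_mul, mul_comm]
      exact le_rfl⟩
  map_add' v w := Subtype.ext (LinearMap.ext fun x => smul_add x v w)
  map_smul' c v := Subtype.ext (LinearMap.ext fun x => smul_comm x c v)
  invFun φ := φ.1 1
  left_inv v := one_smul _ v
  right_inv φ := Subtype.ext (LinearMap.ext fun x => by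
    rw [LinearMap.toSpanSingleton_apply, ← map_smul, smul_eq_mul, mul_one])
  lnorm_map v := by
    apply le_antisymm
    · refine (lnorm_dual_isGLB k _).1 ⟨modulus_nonneg k v, fun x => ?_⟩
      rw [LinearMap.toSpanSingleton_apply, smul_eq_mul, modulus_mul, mul_comm]
      exact le_rfl
    · refine (lnorm_dual_isGLB k _).2 fun M hM => ?_
      have h := hM.2 1
      rw [LinearMap.toSpanSingleton_apply, one_smul] at h
      have h1 : lnorm L (1 : Scalar L k) = 1 := by
        have := modulus_ofL_of_nonneg (L := L) k zero_le_one
        rwa [map_one] at this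
      rwa [h1, mul_one] at h

end Sequence

end LAnalysis

end

open LAnalysis in
theorem mainTheorem4 {L : Type*} [CommRing L] [ConditionallyCompleteLattice L] [IsOrderedRing L]
    [Algebra ℝ L] [IsOrderedModule ℝ L] [IsFAlgebra L] (k : ScalarKind)
    {S : Type*} [Nonempty S]
    {Y : Type*} [AddCommGroup Y] [Module (Scalar L k) Y] [LNorm L Y] [IsLNormedSpace L k Y]
    (p q : ℝ≥0∞) [Fact (1 ≤ p)] [Fact (1 ≤ q)] (hp : p ≠ ∞) (hpq : p⁻¹ + q⁻¹ = 1) :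
    (∃ B : lp L k S Y p →ₗ[Scalar L k] lp L k S (Dual L k Y) q →ₗ[Scalar L k] Scalar L k,
      (∀ f g, HasLSum L (fun s => g.1 s (f.1 s)) (B f g)) ∧
      ∃ Φ : LIsometryEquiv L k (lp L k S (Dual L k Y) q) (Dual L k (lp L k S Y p)),
        ∀ g f, Φ.toLinearEquiv g f = B f g) ∧
    (∃ B : c0 L k S Y →ₗ[Scalar L k] lp L k S (Dual L k Y) 1 →ₗ[Scalar L k] Scalar L k,
      (∀ f g, HasLSum L (fun s => g.1 s (f.1 s)) (B f g)) ∧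
      ∃ Φ : LIsometryEquiv L k (lp L k S (Dual L k Y) 1) (Dual L k (c0 L k S Y)),
        ∀ g f, Φ.toLinearEquiv g f = B f g) ∧
    (∃ B : lp L k S (Scalar L k) p →ₗ[Scalar L k] lp L k S (Scalar L k) q →ₗ[Scalar L k]
        Scalar L k,
      (∀ f g, HasLSum L (fun s => f.1 s * g.1 s) (B f g)) ∧
      ∃ Φ : LIsometryEquiv L k (lp L k S (Scalar L k) q) (Dual L k (lp L k S (Scalar L k) p)),
        ∀ g f, Φ.toLinearEquiv g f = B f g) ∧
    (∃ B : c0 L k S (Scalar L k) →ₗ[Scalar L k] lp L k S (Scalar L k) 1 →ₗ[Scalar L k]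
        Scalar L k,
      (∀ f g, HasLSum L (fun s => f.1 s * g.1 s) (B f g)) ∧
      ∃ Φ : LIsometryEquiv L k (lp L k S (Scalar L k) 1) (Dual L k (c0 L k S (Scalar L k))),
        ∀ g f, Φ.toLinearEquiv g f = B f g) := by
  let J : LIsometryEquiv L k (Dual L k Y) (Dual L k Y) := ⟨LinearEquiv.refl _ _, fun _ => rfl⟩
  exact ⟨exists_duality_lp J hp hpq, exists_duality_c0 J,
    exists_duality_lp (scalarDual L k) hp hpq, exists_duality_c0 (scalarDual L k)⟩
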